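/- **Theorem 5.1.** For $c>0$ let $d(c)>0$ be defined by $e^{c}=1+\frac{d(c)^2}{4(1+d(c))}$, and let $f_c$ be the conformal map of $\Delta=\{|z|>1\}$ onto $\Delta\setminus(1,1+d(c)]$ with $f_c(z)=e^{c}z+\mathcal O(1)$ at infinity. Let $\mathbf c>0$, let $(c_k)_{k\ge 1}$ be a deterministic sequence with $0<c_k\le \mathbf c$ for all $k$, and let $(\theta_k)_{k\ge 1}$ be independent random variables, uniformly distributed on $[0,2\pi)$. Put $f_k(z)=e^{i\theta_k}f_{c_k}(e^{-i\theta_k}z)$, $\Phi_n=f_1\circ\cdots\circ f_n$ and $C_n=\sum_{k=1}^n c_k$, and let $\tilde\Phi_n(z)=\log \Phi_n(e^z)$, $\operatorname{Re} z>0$, be the holomorphic branch with $\tilde\Phi_n(z)=z+C_n+o(1)$ as $\operatorname{Re} z\to\infty$. There are absolute constants $A,A'>0$ such that, for all such $\mathbf c$, $(c_k)$ and $(\theta_k)$, all $N\in\mathbb N$, all $\sigma>0$ and all $0<\epsilon<\sigma/3$ satisfying $\sigma-3\epsilon>d(\mathbf c)\vee \mathbf c^{1/3}$, $$\mathbb P\Big(\sup_{\operatorname{Re}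 z>\sigma,\ n\le N}|\tilde\Phi_n(z)-z-C_n|<\epsilon\Big)\ \ge\ 1-A\,N\,\frac{\mathbf c^{8/5}}{\epsilon^{11/5}\,[(\sigma-3\epsilon)^{9/5}\wedge 1]}\exp\Big(-A(\sigma,\epsilon,N)\,\frac{\epsilon^2}{\mathbf c}\Big),$$ where $$A(\sigma,\epsilon,N)=\frac{A'}{\log\frac1{\sigma-3\epsilon}+\log(\sigma+N\epsilon)+\frac{\epsilon}{\sigma-\epsilon}}.$$ -/

import Mathlib

open MeasureTheory ProbabilityTheory

noncomputable section

namespace HastingsLevitov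

/-- The exterior unit disk `Δ`. -/
def extDisk : Set ℂ := {z | 1 < ‖z‖}

/-- The length `d(c)` of a slit of capacity `c`: the nonnegative solution of
`e^c = 1 + d² / (4 (1 + d))`; see `exp_eq_slitLength`. -/
def slitLength (c : ℝ) : ℝ :=
  2 * (Real.exp c - 1) + 2 * √(Real.exp c * (Real.exp c - 1))

/-- The Cayley transform, taking `Δ ∪ {∞}` to the right half-plane and `∞` to `1`. -/
def cayley (z : ℂ) : ℂ := (z - 1) / (z + 1)

/-- The image of the point `z` under `f_c`, in the right half-plane (principal square root). -/
def halfPlaneSlit (c : ℝ) (z : ℂ) : ℂ :=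
  ((1 - Real.exp (-c) : ℝ) + (Real.exp (-c) : ℝ) * cayley z ^ 2 : ℂ) ^ (1 / 2 : ℂ)

/-- The slit map `f_c`, the conformal map of `Δ` onto `Δ \ (1, 1 + d(c)]` with
`f_c(z) = e^c z + O(1)` at infinity, in explicit form. That it is this map is proved below:
`differentiableOn_slitMap`, `injOn_slitMap`, `image_slitMap`, `slitMap_isBigO`. -/
def slitMap (c : ℝ) (z : ℂ) : ℂ := (1 + halfPlaneSlit c z) / (1 - halfPlaneSlit c z)

/-- The rotated slit map `z ↦ e^{iθ} f_c(e^{-iθ} z)`. -/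
def rotSlitMap (c θ : ℝ) (z : ℂ) : ℂ :=
  Complex.exp (θ * Complex.I) * slitMap c (Complex.exp (-(θ * Complex.I)) * z)

/-- The cluster map `Φ_n = f_1 ∘ ⋯ ∘ f_n`, with `Φ_0 = id`. The sequences are indexed from `0`:
the `(k+1)`-st particle has capacity `c k` and angle `θ k`. -/
def clusterMap (c θ : ℕ → ℝ) : ℕ → ℂ → ℂ
  | 0 => id
  | n + 1 => clusterMap c θ n ∘ rotSlitMap (c n) (θ n)

/-- The total capacity `C_n = c_1 + ⋯ + c_n`. -/
def totalCap (c : ℕ → ℝ) (n : ℕ) : ℝ := ∑ k ∈ Finset.range n, c k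

/-- The slit map in logarithmic coordinates, `log f_c(e^z)`, with the branch of the logarithm
for which it is `z + c + o(1)` as `Re z → ∞`. -/
def logSlitMap (c : ℝ) (z : ℂ) : ℂ := z + Complex.log (slitMap c (Complex.exp z) / Complex.exp z)

/-- The rotated slit map in logarithmic coordinates. -/
def logRotSlitMap (c θ : ℝ) (z : ℂ) : ℂ := θ * Complex.I + logSlitMap c (z - θ * Complex.I)

/-- The cluster map in logarithmic coordinates, `Φ̃_n(z) = log Φ_n(e^z)`, with the branch of the
logarithm for which it is `z + C_n + o(1)` as `Re z → ∞`; see `exp_logClusterMap`,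
`differentiableOn_logClusterMap` and `tendsto_logClusterMap`, which determine it. -/
def logClusterMap (c θ : ℕ → ℝ) : ℕ → ℂ → ℂ
  | 0 => id
  | n + 1 => logClusterMap c θ n ∘ logRotSlitMap (c n) (θ n)

lemma slitLength_nonneg {c : ℝ} (hc : 0 ≤ c) : 0 ≤ slitLength c := by
  have := Real.one_le_exp hc
  unfold slitLength
  have := Real.sqrt_nonneg (Real.exp c * (Real.exp c - 1))
  linarith

lemma exp_eq_slitLength {c : ℝ} (hc : 0 ≤ c) :
    Real.exp c = 1 + slitLength c ^ 2 / (4 * (1 + slitLength c)) := by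
  have h0 := slitLength_nonneg hc
  have h1 := Real.one_le_exp hc
  have h2 : √(Real.exp c * (Real.exp c - 1)) ^ 2 = Real.exp c * (Real.exp c - 1) :=
    Real.sq_sqrt (by nlinarith)
  have h3 : slitLength c ^ 2 = (Real.exp c - 1) * (4 * (1 + slitLength c)) := by
    unfold slitLength
    linear_combination 4 * h2
  rw [h3, mul_div_assoc, div_self (by positivity)]
  ring

lemma add_one_ne {z : ℂ} (hz : z ∈ extDisk) : z + 1 ≠ 0 := by
  intro h
  have : z = -1 := by linear_combination h
  simp [extDisk, this] at hz

lemma cayley_re_pos {z : ℂ} (hz : z ∈ extDisk) : 0 < (cayley z).re := by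
  have h1 := Complex.normSq_pos.2 (add_one_ne hz)
  have h2 : 1 < z.re * z.re + z.im * z.im := by
    rw [← Complex.normSq_apply, Complex.normSq_eq_norm_sq]
    have : 1 < ‖z‖ := hz
    nlinarith
  unfold cayley
  rw [Complex.div_re, ← add_div]
  apply div_pos _ h1
  simp
  nlinarith

lemma cayley_im {z : ℂ} : (cayley z).im = 2 * z.im / Complex.normSq (z + 1) := by
  unfold cayley
  rw [Complex.div_im, ← sub_div]
  congr 1
  simp
  ring

lemma mem_extDisk_of_re_pos {t : ℂ} (h : 0 < t.re) (h1 : t ≠ 1) : (1 + t) / (1 - t) ∈ extDisk := by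
  have h2 : 0 < ‖1 - t‖ := norm_pos_iff.2 (sub_ne_zero.2 (Ne.symm h1))
  show 1 < ‖(1 + t) / (1 - t)‖
  rw [norm_div, one_lt_div h2]
  apply lt_of_pow_lt_pow_left₀ 2 (norm_nonneg _)
  rw [← Complex.normSq_eq_norm_sq, ← Complex.normSq_eq_norm_sq, Complex.normSq_apply,
    Complex.normSq_apply]
  simp
  nlinarith

lemma sq_mem_slitPlane {t : ℂ} (h : 0 < t.re) : t ^ 2 ∈ Complex.slitPlane := by
  rw [Complex.mem_slitPlane_iff]
  by_cases h1 : t.im = 0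
  · left
    simp [pow_two, h1]
    exact h.ne'
  · right
    simp [pow_two]
    intro h2
    have : t.re * t.im = 0 := by linarith
    rcases mul_eq_zero.1 this with h3 | h3
    · exact h.ne' h3
    · exact h1 h3

lemma affine_mem_slitPlane {a b : ℝ} (ha : 0 ≤ a) (hb : 0 < b) {u : ℂ}
    (hu : u ∈ Complex.slitPlane) : (a + b * u : ℂ) ∈ Complex.slitPlane := by
  rw [Complex.mem_slitPlane_iff] at hu ⊢
  rcases hu with h | h
  · left
    simp
    positivity
  · right
    simp
    exact ⟨hb.ne', h⟩

lemma one_sub_exp_nonneg {c : ℝ} (hc : 0 ≤ c) : 0 ≤ 1 - Real.exp (-c) := by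
  have : Real.exp (-c) ≤ 1 := Real.exp_le_one_iff.2 (by linarith)
  linarith

lemma base_mem_slitPlane {c : ℝ} (hc : 0 ≤ c) {z : ℂ} (hz : z ∈ extDisk) :
    ((1 - Real.exp (-c) : ℝ) + (Real.exp (-c) : ℝ) * cayley z ^ 2 : ℂ) ∈ Complex.slitPlane :=
  affine_mem_slitPlane (one_sub_exp_nonneg hc) (Real.exp_pos _)
    (sq_mem_slitPlane (cayley_re_pos hz))

lemma sqrt_re_pos {u : ℂ} (hu : u ∈ Complex.slitPlane) : 0 < (u ^ (1 / 2 : ℂ)).re := by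
  have h0 := Complex.slitPlane_ne_zero hu
  rw [Complex.cpow_def_of_ne_zero h0, Complex.exp_re]
  apply mul_pos (Real.exp_pos _)
  apply Real.cos_pos_of_mem_Ioo
  have h1 := Complex.neg_pi_lt_arg u
  have h2 := (Complex.arg_le_pi u).lt_of_ne (Complex.mem_slitPlane_iff_arg.1 hu).1
  have : (Complex.log u * (1 / 2)).im = u.arg / 2 := by
    simp [Complex.mul_im, Complex.log_im]
    ring
  rw [this]
  constructor <;> linarith

lemma sqrt_sq (u : ℂ) : (u ^ (1 / 2 : ℂ)) ^ 2 = u := by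
  rw [one_div]
  exact_mod_cast Complex.cpow_nat_inv_pow u two_ne_zero

lemma eq_of_sq_eq {s t : ℂ} (hs : 0 < s.re) (ht : 0 < t.re) (h : s ^ 2 = t ^ 2) : s = t := by
  rcases sq_eq_sq_iff_eq_or_eq_neg.1 h with h | h
  · exact h
  · rw [h] at hs
    simp at hs
    linarith

lemma halfPlaneSlit_sq (c : ℝ) (z : ℂ) : halfPlaneSlit c z ^ 2 =
    ((1 - Real.exp (-c) : ℝ) + (Real.exp (-c) : ℝ) * cayley z ^ 2 : ℂ) := sqrt_sq _

lemma halfPlaneSlit_re_pos {c : ℝ} (hc : 0 ≤ c) {z : ℂ} (hz : z ∈ extDisk) :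
    0 < (halfPlaneSlit c z).re := sqrt_re_pos (base_mem_slitPlane hc hz)

lemma cayley_ne_one {z : ℂ} (hz : z ∈ extDisk) : cayley z ≠ 1 := by
  unfold cayley
  rw [Ne, div_eq_one_iff_eq (add_one_ne hz)]
  intro h
  have h2 : (2 : ℂ) = 0 := by linear_combination -h
  norm_num at h2

lemma halfPlaneSlit_ne_one {c : ℝ} {z : ℂ} (hz : z ∈ extDisk) :
    halfPlaneSlit c z ≠ 1 := by
  intro h
  have h1 := halfPlaneSlit_sq c z
  rw [h] at h1
  have he : (Real.exp (-c) : ℂ) ≠ 0 := by exact_mod_cast (Real.exp_pos _).ne'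
  have h2 : cayley z ^ 2 = 1 ^ 2 := by
    apply mul_left_cancel₀ he
    push_cast at h1 ⊢
    linear_combination -h1
  exact cayley_ne_one hz (eq_of_sq_eq (cayley_re_pos hz) (by simp) h2)

lemma slitMap_mem {c : ℝ} (hc : 0 ≤ c) {z : ℂ} (hz : z ∈ extDisk) : slitMap c z ∈ extDisk :=
  mem_extDisk_of_re_pos (halfPlaneSlit_re_pos hc hz) (halfPlaneSlit_ne_one hz)

lemma differentiableOn_slitMap {c : ℝ} (hc : 0 ≤ c) :
    DifferentiableOn ℂ (slitMap c) extDisk := by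
  intro z hz
  apply DifferentiableAt.differentiableWithinAt
  have h1 : DifferentiableAt ℂ cayley z := by
    unfold cayley
    exact DifferentiableAt.div (by fun_prop) (by fun_prop) (add_one_ne hz)
  have h2 : DifferentiableAt ℂ (halfPlaneSlit c) z := by
    unfold halfPlaneSlit
    exact DifferentiableAt.cpow (by fun_prop) (by fun_prop) (base_mem_slitPlane hc hz)
  unfold slitMap
  exact DifferentiableAt.div (by fun_prop) (by fun_prop)
    (sub_ne_zero.2 (halfPlaneSlit_ne_one hz).symm)

lemma injOn_slitMap {c : ℝ} : Set.InjOn (slitMap c) extDisk := by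
  intro z hz w hw h
  have hz1 := sub_ne_zero.2 (halfPlaneSlit_ne_one (c := c) hz).symm
  have hw1 := sub_ne_zero.2 (halfPlaneSlit_ne_one (c := c) hw).symm
  unfold slitMap at h
  rw [div_eq_div_iff hz1 hw1] at h
  have h1 : halfPlaneSlit c z = halfPlaneSlit c w := by linear_combination h / 2
  have h2 : cayley z ^ 2 = cayley w ^ 2 := by
    have he : (Real.exp (-c) : ℂ) ≠ 0 := by exact_mod_cast (Real.exp_pos _).ne'
    apply mul_left_cancel₀ he
    have h3 := halfPlaneSlit_sq c z
    rw [h1, halfPlaneSlit_sq c w] at h3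
    linear_combination -h3
  have h3 := eq_of_sq_eq (cayley_re_pos hz) (cayley_re_pos hw) h2
  unfold cayley at h3
  rw [div_eq_div_iff (add_one_ne hz) (add_one_ne hw)] at h3
  linear_combination h3 / 2

/-- The slit `(1, 1 + d(c)]`. -/
def slit (c : ℝ) : Set ℂ := (fun x : ℝ => (x : ℂ)) '' Set.Ioc 1 (1 + slitLength c)

/-- A real number `s ∈ [0, 1)` corresponds to a point of the closed slit iff
`s² ≤ 1 - e^{-c}`. -/
lemma real_slit_iff {c : ℝ} (hc : 0 ≤ c) {s : ℝ} (hs : 0 ≤ s) (hs1 : s < 1) :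
    (1 + s) / (1 - s) ≤ 1 + slitLength c ↔ s ^ 2 ≤ 1 - Real.exp (-c) := by
  have he := Real.exp_pos (-c)
  have ha0 : 0 ≤ 1 - Real.exp (-c) := one_sub_exp_nonneg hc
  obtain ⟨a, ha⟩ : ∃ a, a = √(1 - Real.exp (-c)) := ⟨_, rfl⟩
  have ha1 : 0 ≤ a := ha ▸ Real.sqrt_nonneg _
  have ha2 : a ^ 2 = 1 - Real.exp (-c) := by rw [ha]; exact Real.sq_sqrt ha0
  have ha3 : a < 1 := by nlinarith
  have hE : Real.exp c * Real.exp (-c) = 1 := by rw [← Real.exp_add]; simp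
  have hE' : Real.exp c * (1 - a ^ 2) = 1 := by rw [ha2]; linarith
  have hpos := Real.exp_pos c
  have hsq : √(Real.exp c * (Real.exp c - 1)) = Real.exp c * a := by
    rw [Real.sqrt_eq_iff_eq_sq (by nlinarith [Real.one_le_exp hc]) (by positivity)]
    have : Real.exp c * a ^ 2 = Real.exp c - 1 := by linarith
    linear_combination -Real.exp c * this
  have hd : 1 + slitLength c = (1 + a) / (1 - a) := by
    rw [eq_div_iff (by linarith)]
    unfold slitLength
    rw [hsq]
    linear_combination 2 * hE'
  rw [hd, div_le_div_iff₀ (by linarith) (by linarith), ← ha2]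
  constructor
  · intro h
    have : s ≤ a := by linarith
    exact pow_le_pow_left₀ hs this 2
  · intro h
    have : s ≤ a := le_of_sq_le_sq h ha1
    nlinarith

lemma image_slitMap {c : ℝ} (hc : 0 ≤ c) : slitMap c '' extDisk = extDisk \ slit c := by
  have he := Real.exp_pos (-c)
  have heC : (Real.exp (-c) : ℂ) ≠ 0 := by exact_mod_cast he.ne'
  ext w
  constructor
  · rintro ⟨z, hz, rfl⟩
    refine ⟨slitMap_mem hc hz, ?_⟩
    rintro ⟨x, ⟨hx1, hx2⟩, hx⟩
    have hS1 := sub_ne_zero.2 (halfPlaneSlit_ne_one (c := c) hz).symm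
    simp only at hx
    unfold slitMap at hx
    rw [eq_div_iff hS1] at hx
    have hx0 : (x : ℂ) + 1 ≠ 0 := by
      have : x + 1 ≠ 0 := by linarith
      exact_mod_cast this
    have hS : halfPlaneSlit c z = ((x - 1) / (x + 1) : ℝ) := by
      push_cast
      rw [eq_div_iff hx0]
      linear_combination -hx
    have hs0 : 0 ≤ (x - 1) / (x + 1) := div_nonneg (by linarith) (by linarith)
    have hs1 : (x - 1) / (x + 1) < 1 := by rw [div_lt_one (by linarith)]; linarith
    have hxx : (1 + (x - 1) / (x + 1)) / (1 - (x - 1) / (x + 1)) = x := by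
      have : x + 1 ≠ 0 := by linarith
      field_simp
      ring
    have hle := (real_slit_iff hc hs0 hs1).1 (by rw [hxx]; exact hx2)
    have hsq := halfPlaneSlit_sq c z
    rw [hS] at hsq
    have ht : cayley z ^ 2 =
        (((((x - 1) / (x + 1)) ^ 2 - (1 - Real.exp (-c))) / Real.exp (-c) : ℝ) : ℂ) := by
      rw [Complex.ofReal_div, eq_div_iff heC]
      push_cast at hsq ⊢
      linear_combination -hsq
    have hp := sq_mem_slitPlane (cayley_re_pos hz)
    rw [ht, Complex.ofReal_mem_slitPlane] at hp
    have := div_nonpos_of_nonpos_of_nonneg (sub_nonpos.2 hle) he.le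
    linarith
  · rintro ⟨hw, hws⟩
    have hS0 := cayley_re_pos hw
    have hS1 := cayley_ne_one hw
    have hwS : (1 + cayley w) / (1 - cayley w) = w := by
      rw [div_eq_iff (sub_ne_zero.2 hS1.symm)]
      unfold cayley
      have := add_one_ne hw
      field_simp
      ring
    obtain ⟨u, hu⟩ : ∃ u : ℂ, u = (cayley w ^ 2 - (1 - Real.exp (-c) : ℝ)) / (Real.exp (-c) : ℝ) :=
      ⟨_, rfl⟩
    have hu' : ((1 - Real.exp (-c) : ℝ) + (Real.exp (-c) : ℝ) * u : ℂ) = cayley w ^ 2 := by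
      rw [hu]
      field_simp
      ring
    have husl : u ∈ Complex.slitPlane := by
      by_contra hn
      rw [Complex.mem_slitPlane_iff] at hn
      push Not at hn
      have hre := congrArg Complex.re hu'
      have him := congrArg Complex.im hu'
      simp [pow_two, hn.2, -Complex.ofReal_exp] at hre him
      have him0 : (cayley w).im = 0 := by
        have h3 : (cayley w).re * (cayley w).im = 0 := by linarith
        rcases mul_eq_zero.1 h3 with h3 | h3
        · exact absurd h3 hS0.ne'
        · exact h3
      rw [him0] at hre
      have hle : (cayley w).re ^ 2 ≤ 1 - Real.exp (-c) := by
        have := mul_nonpos_of_nonneg_of_nonpos he.le hn.1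
        nlinarith
      have hlt : (cayley w).re < 1 := by nlinarith
      have hreal : cayley w = ((cayley w).re : ℂ) := by
        apply Complex.ext <;> simp [him0]
      apply hws
      refine ⟨(1 + (cayley w).re) / (1 - (cayley w).re), ⟨?_, ?_⟩, ?_⟩
      · rw [one_lt_div (by linarith)]
        linarith
      · exact (real_slit_iff hc hS0.le hlt).2 hle
      · push_cast
        rw [← hreal, hwS]
    have ht0 := sqrt_re_pos husl
    have ht2 := sqrt_sq u
    obtain ⟨t, ht⟩ : ∃ t, t = u ^ (1 / 2 : ℂ) := ⟨_, rfl⟩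
    rw [← ht] at ht0 ht2
    have ht1 : t ≠ 1 := by
      intro h
      rw [h] at ht2
      rw [← ht2] at hu'
      push_cast at hu'
      exact hS1 (eq_of_sq_eq hS0 (by simp) (by linear_combination -hu'))
    have htn := sub_ne_zero.2 ht1.symm
    refine ⟨(1 + t) / (1 - t), mem_extDisk_of_re_pos ht0 ht1, ?_⟩
    have hct : cayley ((1 + t) / (1 - t)) = t := by
      unfold cayley
      field_simp
      ring
    have hh : halfPlaneSlit c ((1 + t) / (1 - t)) = cayley w := by
      apply eq_of_sq_eq (halfPlaneSlit_re_pos hc (mem_extDisk_of_re_pos ht0 ht1)) hS0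
      rw [halfPlaneSlit_sq, hct, ht2, hu']
    unfold slitMap
    rw [hh, hwS]

lemma norm_slitMap_sub_le {c : ℝ} (hc : 0 ≤ c) {z : ℂ} (hz : 2 ≤ ‖z‖) :
    ‖slitMap c z - Real.exp c * z‖ ≤ 30 * Real.exp c := by
  have hzD : z ∈ extDisk := by
    show 1 < ‖z‖
    linarith
  have he := Real.exp_pos (-c)
  have heC : (Real.exp (-c) : ℂ) ≠ 0 := by exact_mod_cast he.ne'
  have hE : (Real.exp c : ℂ) * (Real.exp (-c) : ℝ) = 1 := by
    rw [← Complex.ofReal_mul, ← Real.exp_add]; simp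
  have hz1 := add_one_ne hzD
  have hz0 : z ≠ 0 := by
    intro h
    simp [h] at hz
    linarith
  have hS1 := sub_ne_zero.2 (halfPlaneSlit_ne_one (c := c) hzD).symm
  have hS0 := halfPlaneSlit_re_pos hc hzD
  have hsq := halfPlaneSlit_sq c z
  obtain ⟨S, hS⟩ : ∃ S, S = halfPlaneSlit c z := ⟨_, rfl⟩
  have hmap : slitMap c z = (1 + S) / (1 - S) := by rw [hS]; rfl
  rw [← hS] at hS1 hS0 hsq
  have hn1 : 1 ≤ ‖1 + S‖ := by
    refine le_trans ?_ (Complex.re_le_norm _)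
    simp
    linarith
  have hn : 1 + S ≠ 0 := by
    intro h
    rw [h] at hn1
    simp at hn1
    linarith
  have hc4 : (1 - cayley z ^ 2) * (z + 1) ^ 2 = 4 * z := by
    unfold cayley
    field_simp
    ring
  have hkey : (1 - S) * (1 + S) * (z + 1) ^ 2 = (Real.exp (-c) : ℝ) * (4 * z) := by
    rw [← hc4]
    push_cast at hsq ⊢
    linear_combination -(z + 1) ^ 2 * hsq
  have hz1n : ‖z‖ / 2 ≤ ‖z + 1‖ := by
    have := norm_sub_le (z + 1) 1
    simp at this
    linarith
  have hz1p : 0 < ‖z + 1‖ := norm_pos_iff.2 hz1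
  have hdel : ‖(1 - S) * (z + 1)‖ ≤ 8 := by
    have h1 := congrArg norm hkey
    rw [norm_mul, norm_mul, norm_pow, norm_mul, norm_mul, Complex.norm_real,
      Real.norm_of_nonneg he.le] at h1
    have h4 : ‖(4 : ℂ)‖ = 4 := by simp
    rw [h4] at h1
    have h2 : Real.exp (-c) ≤ 1 := by
      have := one_sub_exp_nonneg hc
      linarith
    rw [norm_mul]
    have h3 : ‖1 - S‖ * ‖z + 1‖ ^ 2 ≤ 8 * ‖z + 1‖ := by
      calc ‖1 - S‖ * ‖z + 1‖ ^ 2 ≤ ‖1 - S‖ * ‖1 + S‖ * ‖z + 1‖ ^ 2 := by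
            have : ‖1 - S‖ * 1 ≤ ‖1 - S‖ * ‖1 + S‖ := by gcongr
            nlinarith [sq_nonneg ‖z + 1‖]
        _ = Real.exp (-c) * (4 * ‖z‖) := h1
        _ ≤ 1 * (4 * ‖z‖) := by gcongr
        _ ≤ 8 * ‖z + 1‖ := by linarith
    nlinarith
  have hform : slitMap c z - Real.exp c * z =
      Real.exp c * ((2 - (1 - S) * (z + 1)) * (4 * z + (2 - (1 - S) * (z + 1)))) / (4 * z) := by
    have h1 : slitMap c z = Real.exp c * ((1 + S) * (z + 1)) ^ 2 / (4 * z) := by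
      rw [hmap, div_eq_div_iff hS1 (by simpa using hz0)]
      linear_combination (-(1 + S) * Real.exp c) * hkey - (1 + S) * 4 * z * hE
    rw [h1]
    field_simp
    ring
  obtain ⟨D, hD⟩ : ∃ D, D = 2 - (1 - S) * (z + 1) := ⟨_, rfl⟩
  have hDn : ‖D‖ ≤ 10 := by
    rw [hD]
    refine (norm_sub_le _ _).trans ?_
    simp only [Complex.norm_ofNat]
    linarith
  rw [hform, ← hD, norm_div, norm_mul, Complex.norm_real, Real.norm_of_nonneg (Real.exp_pos c).le,
    norm_mul, norm_mul, Complex.norm_ofNat, div_le_iff₀ (by linarith)]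
  have h5 : ‖4 * z + D‖ ≤ 4 * ‖z‖ + 10 := by
    refine (norm_add_le _ _).trans ?_
    rw [norm_mul, Complex.norm_ofNat]
    linarith
  have h6 : ‖D‖ * ‖4 * z + D‖ ≤ 10 * (4 * ‖z‖ + 10) := by gcongr
  nlinarith [Real.exp_pos c]

/-- `f_c(z) = e^c z + O(1)` at infinity. -/
lemma slitMap_isBigO {c : ℝ} (hc : 0 ≤ c) :
    (fun z : ℂ => slitMap c z - Real.exp c * z) =O[Bornology.cobounded ℂ] (fun _ => (1 : ℝ)) := by
  refine Asymptotics.IsBigO.of_bound (30 * Real.exp c) ?_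
  filter_upwards [tendsto_norm_cobounded_atTop.eventually_ge_atTop (2 : ℝ)] with z hz
  simpa using norm_slitMap_sub_le hc hz

lemma exp_mem_extDisk {z : ℂ} : Complex.exp z ∈ extDisk ↔ 0 < z.re := by
  show 1 < ‖Complex.exp z‖ ↔ _
  rw [Complex.norm_exp, Real.one_lt_exp_iff]

lemma ne_zero_of_mem {z : ℂ} (hz : z ∈ extDisk) : z ≠ 0 := by
  rintro rfl
  simp [extDisk] at hz
  linarith

lemma exp_logSlitMap {c : ℝ} (hc : 0 ≤ c) {z : ℂ} (hz : 0 < z.re) :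
    Complex.exp (logSlitMap c z) = slitMap c (Complex.exp z) := by
  have h := ne_zero_of_mem (slitMap_mem hc (exp_mem_extDisk.2 hz))
  unfold logSlitMap
  rw [Complex.exp_add, Complex.exp_log (div_ne_zero h (Complex.exp_ne_zero z)),
    mul_div_cancel₀ _ (Complex.exp_ne_zero z)]

lemma logSlitMap_re_pos {c : ℝ} (hc : 0 ≤ c) {z : ℂ} (hz : 0 < z.re) :
    0 < (logSlitMap c z).re := by
  rw [← exp_mem_extDisk, exp_logSlitMap hc hz]
  exact slitMap_mem hc (exp_mem_extDisk.2 hz)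

lemma logRotSlitMap_re_pos {c θ : ℝ} (hc : 0 ≤ c) {z : ℂ} (hz : 0 < z.re) :
    0 < (logRotSlitMap c θ z).re := by
  unfold logRotSlitMap
  have := logSlitMap_re_pos (z := z - θ * Complex.I) hc (by simpa using hz)
  simpa using this

lemma exp_logRotSlitMap {c θ : ℝ} (hc : 0 ≤ c) {z : ℂ} (hz : 0 < z.re) :
    Complex.exp (logRotSlitMap c θ z) = rotSlitMap c θ (Complex.exp z) := by
  unfold logRotSlitMap rotSlitMap
  rw [Complex.exp_add, exp_logSlitMap hc (by simpa using hz), ← Complex.exp_add]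
  congr 3
  ring

/-- `Φ̃_n` is a logarithm of `Φ_n(e^z)`. -/
lemma exp_logClusterMap {c : ℕ → ℝ} (hc : ∀ k, 0 ≤ c k) (θ : ℕ → ℝ) (n : ℕ) {z : ℂ}
    (hz : 0 < z.re) :
    Complex.exp (logClusterMap c θ n z) = clusterMap c θ n (Complex.exp z) := by
  induction n generalizing z with
  | zero => rfl
  | succ n ih =>
    simp only [logClusterMap, clusterMap, Function.comp_apply]
    rw [ih (logRotSlitMap_re_pos (hc n) hz), exp_logRotSlitMap (hc n) hz]

lemma slitMap_div_mem_slitPlane {c : ℝ} (hc : 0 ≤ c) {z : ℂ} (hz : z ∈ extDisk) :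
    slitMap c z / z ∈ Complex.slitPlane := by
  have he := Real.exp_pos (-c)
  have hz0 := ne_zero_of_mem hz
  have ht0 := cayley_re_pos hz
  have hS0 := halfPlaneSlit_re_pos hc hz
  have hS1 := sub_ne_zero.2 (halfPlaneSlit_ne_one (c := c) hz).symm
  have hsq := halfPlaneSlit_sq c z
  have hN := Complex.normSq_pos.2 hS1
  have hM := Complex.normSq_pos.2 (add_one_ne hz)
  have hre := congrArg Complex.re hsq
  have him := congrArg Complex.im hsq
  simp [pow_two, -Complex.ofReal_exp] at hre him
  have htim := cayley_im (z := z)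
  obtain ⟨S, hS⟩ : ∃ S, S = halfPlaneSlit c z := ⟨_, rfl⟩
  have hmap : slitMap c z = (1 + S) / (1 - S) := by rw [hS]; rfl
  rw [← hS] at hS0 hN hre him
  have hwim : (slitMap c z).im * Complex.normSq (1 - S) = 2 * S.im := by
    rw [hmap, Complex.div_im, ← sub_div, div_mul_cancel₀ _ hN.ne']
    simp
    ring
  have hwre : (slitMap c z).re * Complex.normSq (1 - S) = 1 - S.re ^ 2 - S.im ^ 2 := by
    rw [hmap, Complex.div_re, ← add_div, div_mul_cancel₀ _ hN.ne']
    simp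
    ring
  by_contra hq
  rw [Complex.mem_slitPlane_iff] at hq
  push Not at hq
  obtain ⟨q, hqd⟩ : ∃ q, q = slitMap c z / z := ⟨_, rfl⟩
  rw [← hqd] at hq
  have hw : slitMap c z = q * z := by rw [hqd, div_mul_cancel₀ _ hz0]
  have hw1 : (slitMap c z).re = q.re * z.re := by rw [hw]; simp [hq.2]
  have hw2 : (slitMap c z).im = q.re * z.im := by rw [hw]; simp [hq.2]
  have hti : (cayley z).im * Complex.normSq (z + 1) = 2 * z.im := by
    rw [htim, div_mul_cancel₀ _ hM.ne']
  have him' : S.re * S.im = Real.exp (-c) * ((cayley z).re * (cayley z).im) := by linarith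
  by_cases hzi : z.im = 0
  · have hti0 : (cayley z).im = 0 := by rw [htim, hzi]; simp
    have hSi : S.im = 0 := by
      rw [hti0] at him'
      simpa [hS0.ne'] using him'
    have hzr : z = (z.re : ℂ) := by apply Complex.ext <;> simp [hzi]
    have hz1 : 1 < |z.re| := by
      have h1 : 1 < ‖z‖ := hz
      rw [hzr, Complex.norm_real] at h1
      simpa using h1
    have hx1 : z.re + 1 ≠ 0 := by
      intro h
      rw [show z.re = -1 by linarith] at hz1
      simp at hz1
    have htr : (cayley z).re * (z.re + 1) = z.re - 1 := by
      have h1 : cayley z * (z + 1) = z - 1 := div_mul_cancel₀ _ (add_one_ne hz)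
      have h2 := congrArg Complex.re h1
      simpa [hzi] using h2
    rw [hti0, hSi] at hre
    rw [hSi, pow_two] at hwre
    have hpos : 0 < (slitMap c z).re * z.re := by
      rcases lt_abs.1 hz1 with h | h
      · have h1 : (cayley z).re < 1 := by nlinarith only [htr, h]
        have h2 : (cayley z).re * (cayley z).re < 1 := by nlinarith only [h1, ht0]
        have h3 : S.re * S.re < 1 := by
          have := mul_lt_mul_of_pos_left h2 he
          linarith
        have h4 : 0 < (slitMap c z).re := by
          apply pos_of_mul_pos_left _ hN.le
          rw [hwre]
          linarith
        exact mul_pos h4 (by linarith)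
      · have h1 : 1 < (cayley z).re := by nlinarith only [htr, h]
        have h2 : 1 < (cayley z).re * (cayley z).re := by nlinarith only [h1]
        have h3 : 1 < S.re * S.re := by
          have := mul_lt_mul_of_pos_left h2 he
          linarith
        have h4 : (slitMap c z).re < 0 := by
          by_contra h5
          have := mul_nonneg (not_lt.1 h5) hN.le
          rw [hwre] at this
          linarith
        exact mul_pos_of_neg_of_neg h4 (by linarith)
    rw [hw1] at hpos
    nlinarith only [hpos, mul_nonneg (neg_nonneg.2 hq.1) (mul_self_nonneg z.re)]
  · have h1 : 0 < S.im * z.im := by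
      have h2 : 0 < (cayley z).im * z.im := by
        rw [htim, div_mul_eq_mul_div]
        apply div_pos _ hM
        have := mul_self_pos.2 hzi
        linarith
      have h3 : S.re * (S.im * z.im) =
          Real.exp (-c) * ((cayley z).re * ((cayley z).im * z.im)) := by
        linear_combination z.im * him'
      have h4 : 0 < S.re * (S.im * z.im) := by rw [h3]; positivity
      exact pos_of_mul_pos_right h4 hS0.le
    have h2 : 0 < (slitMap c z).im * z.im := by
      have h3 : 0 < ((slitMap c z).im * z.im) * Complex.normSq (1 - S) := by
        have : ((slitMap c z).im * z.im) * Complex.normSq (1 - S) = 2 * (S.im * z.im) := by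
          linear_combination z.im * hwim
        linarith
      exact pos_of_mul_pos_left h3 hN.le
    rw [hw2] at h2
    nlinarith only [h2, mul_nonneg (neg_nonneg.2 hq.1) (mul_self_nonneg z.im)]

lemma isOpen_extDisk : IsOpen extDisk := isOpen_lt continuous_const continuous_norm

lemma differentiableAt_logSlitMap {c : ℝ} (hc : 0 ≤ c) {z : ℂ} (hz : 0 < z.re) :
    DifferentiableAt ℂ (logSlitMap c) z := by
  have hm := exp_mem_extDisk.2 hz
  have h1 : DifferentiableAt ℂ (slitMap c) (Complex.exp z) :=
    (differentiableOn_slitMap hc).differentiableAt (isOpen_extDisk.mem_nhds hm)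
  have h2 : DifferentiableAt ℂ (fun w => slitMap c (Complex.exp w)) z :=
    h1.comp z Complex.differentiable_exp.differentiableAt
  unfold logSlitMap
  exact differentiableAt_id.add
    ((h2.div Complex.differentiable_exp.differentiableAt (Complex.exp_ne_zero z)).clog
      (slitMap_div_mem_slitPlane hc hm))

/-- `Φ̃_n` is holomorphic on the right half-plane. -/
lemma differentiableOn_logClusterMap {c : ℕ → ℝ} (hc : ∀ k, 0 ≤ c k) (θ : ℕ → ℝ) (n : ℕ) :
    DifferentiableOn ℂ (logClusterMap c θ n) {z | 0 < z.re} := by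
  induction n with
  | zero => exact differentiableOn_id
  | succ n ih =>
    refine DifferentiableOn.comp ih ?_ (fun z hz => logRotSlitMap_re_pos (hc n) hz)
    intro z hz
    apply DifferentiableAt.differentiableWithinAt
    unfold logRotSlitMap
    have h1 : DifferentiableAt ℂ (logSlitMap (c n)) (z - θ n * Complex.I) :=
      differentiableAt_logSlitMap (hc n) (by simpa using hz)
    have h2 : DifferentiableAt ℂ (fun w : ℂ => w - θ n * Complex.I) z := by fun_prop
    exact (differentiableAt_const _).add
      (DifferentiableAt.comp (g := logSlitMap (c n)) z h1 h2)

lemma tendsto_slitMap_div {c : ℝ} (hc : 0 ≤ c) :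
    Filter.Tendsto (fun z => slitMap c z / z) (Bornology.cobounded ℂ)
      (nhds (Real.exp c : ℂ)) := by
  rw [tendsto_iff_norm_sub_tendsto_zero]
  have h1 : Filter.Tendsto (fun z : ℂ => 30 * Real.exp c / ‖z‖) (Bornology.cobounded ℂ)
      (nhds 0) := tendsto_const_nhds.div_atTop tendsto_norm_cobounded_atTop
  refine squeeze_zero' (Filter.Eventually.of_forall fun _ => norm_nonneg _) ?_ h1
  filter_upwards [tendsto_norm_cobounded_atTop.eventually_ge_atTop (2 : ℝ)] with z hz
  have hz0 : z ≠ 0 := by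
    rintro rfl
    simp at hz
    linarith
  have h2 : slitMap c z / z - Real.exp c = (slitMap c z - Real.exp c * z) / z := by
    field_simp
  rw [h2, norm_div]
  gcongr
  exact norm_slitMap_sub_le hc hz

lemma tendsto_logSlitMap {c : ℝ} (hc : 0 ≤ c) :
    Filter.Tendsto (fun z => logSlitMap c z - z) (Filter.comap Complex.re Filter.atTop)
      (nhds (c : ℂ)) := by
  have h1 := (tendsto_slitMap_div hc).comp Complex.tendsto_exp_comap_re_atTop
  have h2 := h1.clog (by
    rw [Complex.ofReal_mem_slitPlane]
    exact Real.exp_pos c)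
  rw [← Complex.ofReal_log (Real.exp_pos c).le, Real.log_exp] at h2
  refine h2.congr fun z => ?_
  simp [logSlitMap]

/-- `Φ̃_n(z) - z → C_n` as `Re z → ∞`. -/
lemma tendsto_logClusterMap {c : ℕ → ℝ} (hc : ∀ k, 0 ≤ c k) (θ : ℕ → ℝ) (n : ℕ) :
    Filter.Tendsto (fun z => logClusterMap c θ n z - z) (Filter.comap Complex.re Filter.atTop)
      (nhds (totalCap c n : ℂ)) := by
  induction n with
  | zero => simpa [logClusterMap, totalCap] using tendsto_const_nhds
  | succ n ih =>
    have hr : Filter.Tendsto Complex.re (Filter.comap Complex.re Filter.atTop) Filter.atTop :=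
      Filter.tendsto_comap
    have h0 : Filter.Tendsto (fun z : ℂ => z - θ n * Complex.I)
        (Filter.comap Complex.re Filter.atTop) (Filter.comap Complex.re Filter.atTop) := by
      rw [Filter.tendsto_comap_iff]
      refine hr.congr fun z => ?_
      simp
    have h1 : Filter.Tendsto (fun z => logRotSlitMap (c n) (θ n) z - z)
        (Filter.comap Complex.re Filter.atTop) (nhds (c n : ℂ)) := by
      refine ((tendsto_logSlitMap (hc n)).comp h0).congr fun z => ?_
      simp only [Function.comp_apply, logRotSlitMap]
      ring
    have h2 : Filter.Tendsto (logRotSlitMap (c n) (θ n))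
        (Filter.comap Complex.re Filter.atTop) (Filter.comap Complex.re Filter.atTop) := by
      rw [Filter.tendsto_comap_iff]
      have h3 := (Complex.continuous_re.tendsto _).comp h1
      refine (Filter.Tendsto.add_atTop h3 hr).congr fun z => ?_
      simp
    have h4 := (ih.comp h2).add h1
    have h5 : (totalCap c (n + 1) : ℂ) = totalCap c n + c n := by
      simp [totalCap, Finset.sum_range_succ]
    rw [h5]
    refine h4.congr fun z => ?_
    simp [logClusterMap]

end HastingsLevitov

end

/-! In logarithmic coordinates every cluster map `H` is a `2πi`-periodic self-map of the right
half-plane, so `H(z) - z` is a holomorphic function `k` of `w = e^{-z}` on the unit disk, with `k(0)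
= T`, the total capacity. The minimum principle gives `Re k ≥ 0`. Hence maps only push points to the
right, and `|H(z) - z - T| ≤ 2T / (e^{Re z} - 1)`.

Rotating by a uniform angle averages `k` over a circle. By the mean value property the centred
displacement `ξ` of one particle of capacity `a` satisfies `E ξ = 0` and `E ξ² = 0`. With the
one-sided bound `Re ξ ≥ -a`, this gives `E |ξ|² ≤ 4a²b`, where `b = 1/(e^x - 1)` and `x = Re z`: one
factor `b` rather than the `b²` that the supremum bound yields (`integral_exp_re_le`).

Since `Φ_{n+1} = Φ_n ∘ f_{n+1}`, the deviation at `z` is the last jump plus the deviation of the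
earlier map at the displaced point. As the points drift right, the variance accumulates like `c ∫
dy/(e^y - 1)`, which is `c` times `variancePotential`. That potential is a Lyapunov function:
concavity of `log(1 - e^{-y})` makes it lose enough per jump, up to a centred term, to pay for the
variance (`variancePotential_jump`). Induction on the number of particles yields a Gaussian
exponential moment at each fixed point (`lintegral_exp_clusterFluct_le`).

Two suprema remain. For `z`, the function `exp(λ(k - T))` is itself holomorphic, so Cauchy's formula
bounds it throughout a smaller disk by its mean on one circle, whose expectation is controlled; no
grid of points is needed (`measure_clusterFluct_ge_le`). For `n`, it suffices to look when the total
capacity passes multiples of a step `w`: in between, the maps differ by composition with a map of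
capacity at most `w` (`norm_clusterFluct_le_of_hitTime`).

The resulting estimate is then compared with the stated one. If `Nc/ε` is small the event is
certain; if `c > ε` or `c > 1` (and `Nc/ε` is not small) the stated error is at least 1; otherwise
interpolation with the trivial bound `p ≤ 1` gives exactly the required powers
(`prob_le_of_small_cap`). -/

namespace HastingsLevitov

open Filter Topology Metric

/-! ### Displacements as Herglotz functions of `e^{-z}`. -/

/-- A holomorphic self-map of the right half-plane which commutes with the translation by `2πi`
and is `z + T + o(1)` as `Re z → ∞`. -/
structure IsLogMap (H : ℂ → ℂ) (T : ℝ) : Prop where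
  differentiableOn : DifferentiableOn ℂ H {z | 0 < z.re}
  add_period : ∀ z, H (z + 2 * Real.pi * Complex.I) = H z + 2 * Real.pi * Complex.I
  re_pos : ∀ z, 0 < z.re → 0 < (H z).re
  tendsto : Tendsto (fun z => H z - z) (comap Complex.re atTop) (𝓝 (T : ℂ))

lemma isOpen_re_pos : IsOpen {z : ℂ | 0 < z.re} := isOpen_lt continuous_const Complex.continuous_re

/-- A `2πi`-periodic holomorphic function on the right half-plane with a limit at infinity is a
holomorphic function of `e^{-z}` in the unit disk. -/
lemma exists_disk_function {u : ℂ → ℂ} {T : ℂ} (hd : DifferentiableOn ℂ u {z | 0 < z.re})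
    (hp : ∀ z, u (z + 2 * Real.pi * Complex.I) = u z)
    (ht : Tendsto u (comap Complex.re atTop) (𝓝 T)) :
    ∃ k : ℂ → ℂ, DifferentiableOn ℂ k (ball 0 1) ∧ k 0 = T ∧
      ∀ z, k (Complex.exp (-z)) = u z := by
  -- A quarter turn carries the upper half-plane to the right one, so that `k` is the cusp function
  -- of `f` for the period `2π`.
  set f : ℂ → ℂ := fun τ => u (-Complex.I * τ) with hf
  have hh : (0 : ℝ) < 2 * Real.pi := Real.two_pi_pos
  have hpf : Function.Periodic f ((2 * Real.pi : ℝ) : ℂ) := by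
    intro τ
    have h := hp (-Complex.I * (τ + (2 * Real.pi : ℝ)))
    simp only [hf]
    rw [← h]
    congr 1
    push_cast
    ring
  have hq : ∀ τ : ℂ, Function.Periodic.qParam (2 * Real.pi) τ = Complex.exp (Complex.I * τ) := by
    intro τ
    unfold Function.Periodic.qParam
    congr 1
    have : (Real.pi : ℂ) ≠ 0 := by exact_mod_cast Real.pi_ne_zero
    push_cast
    field_simp
  have hdf : ∀ τ : ℂ, 0 < τ.im → DifferentiableAt ℂ f τ := by
    intro τ hτ
    have h1 : DifferentiableAt ℂ u (-Complex.I * τ) :=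
      hd.differentiableAt (isOpen_re_pos.mem_nhds (by simpa using hτ))
    exact DifferentiableAt.comp (g := u) τ h1 (by fun_prop)
  have htf : Tendsto f (comap Complex.im atTop) (𝓝 T) := by
    refine ht.comp ?_
    rw [tendsto_comap_iff]
    refine (tendsto_comap (f := Complex.im)).congr fun τ => ?_
    simp
  have hev : ∀ᶠ τ in comap Complex.im atTop, DifferentiableAt ℂ f τ :=
    (tendsto_comap.eventually (eventually_gt_atTop 0)).mono hdf
  have hbd : BoundedAtFilter (comap Complex.im atTop) f := htf.isBigO_one ℝ
  refine ⟨Function.Periodic.cuspFunction (2 * Real.pi) f, ?_, ?_, ?_⟩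
  · intro w hw
    apply DifferentiableAt.differentiableWithinAt
    by_cases h0 : w = 0
    · rw [h0]
      exact Function.Periodic.differentiableAt_cuspFunction_zero hh hpf hev hbd
    · have h1 := Function.Periodic.qParam_right_inv hh.ne' h0
      rw [← h1]
      refine Function.Periodic.differentiableAt_cuspFunction hh.ne' hpf (hdf _ ?_)
      rw [Function.Periodic.im_invQParam]
      have h2 : Real.log ‖w‖ < 0 := Real.log_neg (norm_pos_iff.2 h0) (by simpa using hw)
      rw [neg_div, div_self hh.ne']
      linarith
  · have : (comap Complex.im atTop).NeBot :=
      comap_neBot_iff_frequently.2 (Frequently.of_forall fun y => ⟨⟨0, y⟩, rfl⟩)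
    exact tendsto_nhds_unique (Function.Periodic.tendsto_at_I_inf hh hpf hev hbd) htf
  · intro z
    have h1 := Function.Periodic.eq_cuspFunction hh.ne' hpf (Complex.I * z)
    rw [hq, ← mul_assoc, Complex.I_mul_I, neg_one_mul] at h1
    rw [h1]
    simp only [hf]
    congr 1
    rw [← mul_assoc, neg_mul, Complex.I_mul_I]
    ring

/-- A holomorphic function `k` on the unit disk with `log |w| ≤ Re k(w)` has nonnegative real
part. -/
lemma re_nonneg_of_log_norm_le {k : ℂ → ℂ} (hd : DifferentiableOn ℂ k (ball 0 1))
    (hk : ∀ w ∈ ball (0 : ℂ) 1, w ≠ 0 → Real.log ‖w‖ ≤ (k w).re) {w : ℂ} (hw : w ∈ ball (0 : ℂ) 1) :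
    0 ≤ (k w).re := by
  have hw1 : ‖w‖ < 1 := by simpa using hw
  -- Maximum principle for `exp(-k)` on the disk of radius `r`; this also covers the puncture `w =
  -- 0`. Then `r` tends to 1.
  have key : ∀ r : ℝ, ‖w‖ < r → r < 1 → Real.log r ≤ (k w).re := by
    intro r hr hr1
    have hr0 : 0 < r := (norm_nonneg w).trans_lt hr
    have hsub : closedBall (0 : ℂ) r ⊆ ball 0 1 := closedBall_subset_ball hr1
    have hdc : DiffContOnCl ℂ (fun v => Complex.exp (-k v)) (ball 0 r) := by
      apply DifferentiableOn.diffContOnCl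
      rw [closure_ball _ hr0.ne']
      exact (hd.mono hsub).neg.cexp
    have h1 := Complex.norm_le_of_forall_mem_frontier_norm_le isBounded_ball hdc
      (C := Real.exp (-Real.log r)) ?_ (subset_closure (show w ∈ ball (0 : ℂ) r by simpa using hr))
    · rw [Complex.norm_exp, Real.exp_le_exp] at h1
      simp only [Complex.neg_re] at h1
      linarith
    · intro v hv
      rw [frontier_ball _ hr0.ne'] at hv
      have hv1 : ‖v‖ = r := by simpa using hv
      have hv0 : v ≠ 0 := by
        intro h
        rw [h, norm_zero] at hv1
        exact hr0.ne hv1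
      have := hk v (hsub (sphere_subset_closedBall hv)) hv0
      rw [Complex.norm_exp, Real.exp_le_exp, Complex.neg_re, ← hv1]
      linarith
  have ht : Tendsto Real.log (𝓝[<] 1) (𝓝 0) := by
    have := (Real.continuousAt_log one_ne_zero).tendsto
    rw [Real.log_one] at this
    exact this.mono_left nhdsWithin_le_nhds
  refine le_of_tendsto ht ?_
  filter_upwards [Ioo_mem_nhdsLT hw1] with r hr
  exact key r hr.1 hr.2

/-- The displacement `H(z) - z` of a log map is a Herglotz function of `e^{-z}`. -/
lemma IsLogMap.exists_herglotz {H : ℂ → ℂ} {T : ℝ} (h : IsLogMap H T) :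
    ∃ k : ℂ → ℂ, DifferentiableOn ℂ k (ball 0 1) ∧ k 0 = T ∧
      (∀ z, k (Complex.exp (-z)) = H z - z) ∧ ∀ w ∈ ball (0 : ℂ) 1, 0 ≤ (k w).re := by
  obtain ⟨k, hk, hk0, hkz⟩ := exists_disk_function (u := fun z => H z - z)
    (h.differentiableOn.sub differentiableOn_id)
    (fun z => by rw [h.add_period]; ring) h.tendsto
  refine ⟨k, hk, hk0, hkz, fun w hw => re_nonneg_of_log_norm_le hk ?_ hw⟩
  intro v hv hv0
  have h1 : Complex.exp (-(-Complex.log v)) = v := by rw [neg_neg, Complex.exp_log hv0]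
  have h2 := hkz (-Complex.log v)
  rw [h1] at h2
  have h3 : 0 < (-Complex.log v).re := by
    rw [Complex.neg_re, Complex.log_re]
    have := Real.log_neg (norm_pos_iff.2 hv0) (by simpa using hv)
    linarith
  have h4 := h.re_pos _ h3
  rw [h2, Complex.sub_re, Complex.neg_re, Complex.log_re]
  linarith

lemma exp_neg_mem_ball {z : ℂ} (hz : 0 < z.re) : Complex.exp (-z) ∈ ball (0 : ℂ) 1 := by
  rw [mem_ball_zero_iff, Complex.norm_exp, Real.exp_lt_one_iff, Complex.neg_re]
  linarith

lemma IsLogMap.re_le {H : ℂ → ℂ} {T : ℝ} (h : IsLogMap H T) {z : ℂ} (hz : 0 < z.re) :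
    z.re ≤ (H z).re := by
  obtain ⟨k, -, -, hkz, hk⟩ := h.exists_herglotz
  have := hk _ (exp_neg_mem_ball hz)
  rw [hkz, Complex.sub_re] at this
  linarith

/-- Carathéodory bound for a Herglotz function. -/
lemma norm_sub_le_of_herglotz {k : ℂ → ℂ} {T : ℝ} (hd : DifferentiableOn ℂ k (ball 0 1))
    (h0 : k 0 = T) (hk : ∀ w ∈ ball (0 : ℂ) 1, 0 ≤ (k w).re) {w : ℂ} (hw : w ∈ ball (0 : ℂ) 1) :
    ‖k w - T‖ ≤ 2 * T * ‖w‖ / (1 - ‖w‖) := by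
  have hw1 : ‖w‖ < 1 := by simpa using hw
  have hT : 0 ≤ T := by simpa [h0] using hk 0 (by simp)
  -- Borel–Carathéodory for `T - k` needs a strictly positive bound, and `T` may be zero; hence a
  -- limit `M ↓ T`.
  have key : ∀ M : ℝ, T < M → ‖k w - T‖ ≤ 2 * M * ‖w‖ / (1 - ‖w‖) := by
    intro M hM
    rw [norm_sub_rev]
    refine Complex.borelCaratheodory_zero (f := fun v => (T : ℂ) - k v) (hT.trans_lt hM)
      (hd.const_sub _) ?_ one_pos hw (by simp [h0])
    intro v hv
    have := hk v hv
    simp only [Set.mem_ofPred_eq, Complex.sub_re, Complex.ofReal_re]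
    linarith
  have ht : Tendsto (fun M : ℝ => 2 * M * ‖w‖ / (1 - ‖w‖)) (𝓝[>] T)
      (𝓝 (2 * T * ‖w‖ / (1 - ‖w‖))) := by
    refine Tendsto.mono_left (Continuous.tendsto ?_ T) nhdsWithin_le_nhds
    fun_prop
  exact ge_of_tendsto ht (eventually_nhdsWithin_of_forall key)

lemma exp_neg_div_one_sub {x : ℝ} (hx : 0 < x) :
    Real.exp (-x) / (1 - Real.exp (-x)) = 1 / (Real.exp x - 1) := by
  have h1 : 1 < Real.exp x := Real.one_lt_exp_iff.2 hx
  rw [Real.exp_neg]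
  have : Real.exp x - 1 ≠ 0 := by linarith
  have := (Real.exp_pos x).ne'
  field_simp

lemma IsLogMap.norm_sub_le {H : ℂ → ℂ} {T : ℝ} (h : IsLogMap H T) {z : ℂ} (hz : 0 < z.re) :
    ‖H z - z - T‖ ≤ 2 * T / (Real.exp z.re - 1) := by
  obtain ⟨k, hd, h0, hkz, hk⟩ := h.exists_herglotz
  have h1 := norm_sub_le_of_herglotz hd h0 hk (exp_neg_mem_ball hz)
  rw [hkz, Complex.norm_exp, Complex.neg_re, mul_div_assoc, exp_neg_div_one_sub hz] at h1
  rwa [mul_one_div] at h1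

/-! ### Slit and cluster maps as log maps, and their composition. -/

lemma logSlitMap_add_period (c : ℝ) (z : ℂ) :
    logSlitMap c (z + 2 * Real.pi * Complex.I) = logSlitMap c z + 2 * Real.pi * Complex.I := by
  unfold logSlitMap
  rw [Complex.exp_periodic]
  ring

lemma logRotSlitMap_add_period (c θ : ℝ) (z : ℂ) :
    logRotSlitMap c θ (z + 2 * Real.pi * Complex.I) =
      logRotSlitMap c θ z + 2 * Real.pi * Complex.I := by
  unfold logRotSlitMap
  rw [add_sub_right_comm, logSlitMap_add_period]
  ring

lemma logClusterMap_add_period (c θ : ℕ → ℝ) (n : ℕ) (z : ℂ) :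
    logClusterMap c θ n (z + 2 * Real.pi * Complex.I) =
      logClusterMap c θ n z + 2 * Real.pi * Complex.I := by
  induction n generalizing z with
  | zero => rfl
  | succ n ih =>
    simp only [logClusterMap, Function.comp_apply]
    rw [logRotSlitMap_add_period, ih]

lemma isLogMap_logSlitMap {c : ℝ} (hc : 0 ≤ c) : IsLogMap (logSlitMap c) c where
  differentiableOn _ hz := (differentiableAt_logSlitMap hc hz).differentiableWithinAt
  add_period := logSlitMap_add_period c
  re_pos _ hz := logSlitMap_re_pos hc hz
  tendsto := tendsto_logSlitMap hc

lemma isLogMap_logClusterMap {c : ℕ → ℝ} (hc : ∀ k, 0 ≤ c k) (θ : ℕ → ℝ) (n : ℕ) :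
    IsLogMap (logClusterMap c θ n) (totalCap c n) where
  differentiableOn := differentiableOn_logClusterMap hc θ n
  add_period := logClusterMap_add_period c θ n
  re_pos z hz := by
    induction n generalizing z with
    | zero => exact hz
    | succ n ih => exact ih _ (logRotSlitMap_re_pos (hc n) hz)
  tendsto := tendsto_logClusterMap hc θ n

/-- The cluster map after `m + n` particles is the one after `m` particles composed with a cluster
map of the remaining `n` particles. -/
lemma logClusterMap_add (c θ : ℕ → ℝ) (m n : ℕ) (z : ℂ) :
    logClusterMap c θ (m + n) z =
      logClusterMap c θ m (logClusterMap (fun k => c (m + k)) (fun k => θ (m + k)) n z) := by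
  induction n generalizing z with
  | zero => rfl
  | succ n ih =>
    rw [← add_assoc]
    simp only [logClusterMap, Function.comp_apply]
    exact ih _

lemma totalCap_add (c : ℕ → ℝ) (m n : ℕ) :
    totalCap c (m + n) = totalCap c m + totalCap (fun k => c (m + k)) n :=
  Finset.sum_range_add c m n

/-! ### Uniform angles and exponential moments. -/

/-- The uniform distribution on `[0, 2π)`. -/
noncomputable def uniformAngle : Measure ℝ :=
  ProbabilityTheory.cond volume (Set.Ico 0 (2 * Real.pi))

instance : IsProbabilityMeasure uniformAngle := by
  apply cond_isProbabilityMeasure_of_finite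
  · simp [Real.pi_pos]
  · simp [ENNReal.mul_eq_top]

lemma circleAverage_eq_integral_uniformAngle (φ : ℂ → ℂ) (R : ℝ) :
    Real.circleAverage φ 0 R = ∫ t : ℝ, φ (R * Complex.exp (t * Complex.I)) ∂uniformAngle := by
  rw [Real.circleAverage_def, intervalIntegral.integral_of_le Real.two_pi_pos.le,
    uniformAngle, ProbabilityTheory.cond, integral_smul_measure, integral_Ico_eq_integral_Ioc]
  congr 1
  · simp [Real.pi_pos.le]
  · simp [circleMap]

/-- Mean value property for the uniform distribution on a circle. -/
lemma integral_uniformAngle {φ : ℂ → ℂ} (hφ : DifferentiableOn ℂ φ (ball 0 1)) {w : ℂ}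
    (hw : w ∈ ball (0 : ℂ) 1) :
    ∫ t : ℝ, φ (w * Complex.exp (t * Complex.I)) ∂uniformAngle = φ 0 := by
  have hw1 : ‖w‖ < 1 := by simpa using hw
  have h1 : DiffContOnCl ℂ (fun v => φ (w * v)) (ball 0 |1|) := by
    apply DifferentiableOn.diffContOnCl
    rw [abs_one, closure_ball _ one_ne_zero]
    refine hφ.comp (by fun_prop) ?_
    intro v hv
    have hv1 : ‖v‖ ≤ 1 := by simpa using hv
    rw [mem_ball_zero_iff, norm_mul]
    calc ‖w‖ * ‖v‖ ≤ ‖w‖ * 1 := by gcongr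
      _ < 1 := by linarith
  have h2 := h1.circleAverage
  rw [circleAverage_eq_integral_uniformAngle] at h2
  simpa using h2

/-- Exponential moments of a centred complex random variable with vanishing second moment and
bounded below real part. -/
lemma integral_exp_re_le {α : Type*} [MeasurableSpace α] {ν : Measure α} [IsProbabilityMeasure ν]
    {ξ : α → ℂ} (hm : Measurable ξ) {a b : ℝ} (hb : ∀ t, ‖ξ t‖ ≤ 2 * a * b)
    (ha : ∀ t, -a ≤ (ξ t).re) (h1 : ∫ t, ξ t ∂ν = 0) (h2 : ∫ t, ξ t ^ 2 ∂ν = 0)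
    (μ : ℂ) (hμ : ‖μ‖ * (2 * a * b) ≤ 1) :
    ∫ t, Real.exp (μ * ξ t).re ∂ν ≤ Real.exp (4 * ‖μ‖ ^ 2 * a ^ 2 * b) := by
  have iξ : Integrable ξ ν :=
    Integrable.of_bound hm.aestronglyMeasurable (2 * a * b) (Eventually.of_forall hb)
  have iξ2 : Integrable (fun t => ξ t ^ 2) ν := by
    refine Integrable.of_bound (by fun_prop) ((2 * a * b) ^ 2) (Eventually.of_forall fun t => ?_)
    rw [norm_pow]
    gcongr
    exact hb t
  have ire : Integrable (fun t => (ξ t).re) ν := iξ.re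
  have inorm : Integrable (fun t => ‖ξ t‖ ^ 2) ν := by
    simpa using iξ2.norm
  have isq : Integrable (fun t => (ξ t ^ 2).re) ν := iξ2.re
  have ere : ∫ t, (ξ t).re ∂ν = 0 := by
    have := integral_re iξ
    simpa [h1] using this
  have esq : ∫ t, (ξ t ^ 2).re ∂ν = 0 := by
    have := integral_re iξ2
    simpa [h2] using this
  have hsec : ∫ t, ‖ξ t‖ ^ 2 ∂ν ≤ 4 * a ^ 2 * b := by
    have h3 : ∀ t, ‖ξ t‖ ^ 2 ≤ 4 * a ^ 2 * b + (4 * a * b - 2 * a) * (ξ t).re - (ξ t ^ 2).re := by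
      -- Here `|ξ|² = 2(Re ξ)² - Re(ξ²)`, and expanding `(Re ξ + a)(2ab - Re ξ) ≥ 0` bounds `(Re
      -- ξ)²` by `2a²b` plus a multiple of `Re ξ`. Both correction terms integrate to zero.
      intro t
      have hr := (Complex.re_le_norm (ξ t)).trans (hb t)
      have hl := ha t
      rw [← Complex.normSq_eq_norm_sq, Complex.normSq_apply, pow_two (ξ t), Complex.mul_re]
      nlinarith [mul_nonneg (sub_nonneg.2 hr) (sub_nonneg.2 hl)]
    have isum : Integrable (fun t => 4 * a ^ 2 * b + (4 * a * b - 2 * a) * (ξ t).re) ν :=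
      (integrable_const _).add (ire.const_mul _)
    calc ∫ t, ‖ξ t‖ ^ 2 ∂ν
        ≤ ∫ t, (4 * a ^ 2 * b + (4 * a * b - 2 * a) * (ξ t).re - (ξ t ^ 2).re) ∂ν :=
          integral_mono inorm (isum.sub isq) h3
      _ = 4 * a ^ 2 * b := by
          rw [integral_sub isum isq,
            integral_add (integrable_const _) (ire.const_mul _),
            integral_const_mul (4 * a * b - 2 * a), ere, esq]
          simp
  have iμ : Integrable (fun t => (μ * ξ t).re) ν := (iξ.const_mul μ).re
  have eμ : ∫ t, (μ * ξ t).re ∂ν = 0 := by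
    have := integral_re (iξ.const_mul μ)
    rw [integral_const_mul, h1] at this
    simpa using this
  have hpt : ∀ t, |(μ * ξ t).re| ≤ 1 := fun t => by
    refine (Complex.abs_re_le_norm _).trans ?_
    rw [norm_mul]
    exact (mul_le_mul_of_nonneg_left (hb t) (norm_nonneg _)).trans hμ
  have hexp : ∀ t, Real.exp (μ * ξ t).re ≤ 1 + (μ * ξ t).re + ‖μ‖ ^ 2 * ‖ξ t‖ ^ 2 := by
    intro t
    have h3 := Real.abs_exp_sub_one_sub_id_le (hpt t)
    have h4 : (μ * ξ t).re ^ 2 ≤ ‖μ‖ ^ 2 * ‖ξ t‖ ^ 2 := by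
      rw [← mul_pow, ← norm_mul]
      exact sq_le_sq' (by linarith [(abs_le.1 (Complex.abs_re_le_norm (μ * ξ t))).1])
        (Complex.re_le_norm _)
    linarith [(abs_le.1 h3).2]
  have iexp : Integrable (fun t => Real.exp (μ * ξ t).re) ν := by
    refine Integrable.of_bound ?_ (Real.exp 1) (Eventually.of_forall fun t => ?_)
    · exact (Real.measurable_exp.comp
        (Complex.measurable_re.comp (hm.const_mul μ))).aestronglyMeasurable
    · rw [Real.norm_eq_abs, Real.abs_exp, Real.exp_le_exp]
      exact (abs_le.1 (hpt t)).2
  have isum : Integrable (fun t => 1 + (μ * ξ t).re) ν := (integrable_const _).add iμ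
  calc ∫ t, Real.exp (μ * ξ t).re ∂ν
      ≤ ∫ t, (1 + (μ * ξ t).re + ‖μ‖ ^ 2 * ‖ξ t‖ ^ 2) ∂ν :=
        integral_mono iexp (isum.add (inorm.const_mul _)) hexp
    _ = 1 + ‖μ‖ ^ 2 * ∫ t, ‖ξ t‖ ^ 2 ∂ν := by
        rw [integral_add isum (inorm.const_mul _),
          integral_add (integrable_const _) iμ, eμ, integral_const_mul]
        simp
    _ ≤ 1 + ‖μ‖ ^ 2 * (4 * a ^ 2 * b) := by gcongr
    _ ≤ Real.exp (4 * ‖μ‖ ^ 2 * a ^ 2 * b) := by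
        have := Real.add_one_le_exp (4 * ‖μ‖ ^ 2 * a ^ 2 * b)
        linarith

/-! ### The variance potential and its decrease along a jump. -/

/-- The variance accumulated by a particle which starts at distance `x` and moves to the right by
`T`, in units of the capacity: `∫_x^{x+T} dy / (e^y - 1)`. -/
noncomputable def variancePotential (T x : ℝ) : ℝ :=
  Real.log (1 - Real.exp (-(x + T))) - Real.log (1 - Real.exp (-x))

lemma one_sub_exp_neg_pos {x : ℝ} (hx : 0 < x) : 0 < 1 - Real.exp (-x) := by
  have : Real.exp (-x) < 1 := Real.exp_lt_one_iff.2 (by linarith)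
  linarith

lemma exp_sub_one_pos {x : ℝ} (hx : 0 < x) : 0 < Real.exp x - 1 := by
  have := Real.one_lt_exp_iff.2 hx
  linarith

/-- Tangent bound for the concave function `log (1 - e^{-y})`. -/
lemma log_one_sub_exp_neg_sub_le {y ρ : ℝ} (hy : 0 < y) (hyρ : 0 < y + ρ) :
    Real.log (1 - Real.exp (-(y + ρ))) - Real.log (1 - Real.exp (-y)) ≤ ρ / (Real.exp y - 1) := by
  have h1 := one_sub_exp_neg_pos hy
  have h2 := one_sub_exp_neg_pos hyρ
  have h3 := exp_sub_one_pos hy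
  rw [← Real.log_div h2.ne' h1.ne']
  refine (Real.log_le_sub_one_of_pos (div_pos h2 h1)).trans ?_
  rw [div_sub_one h1.ne', div_le_div_iff₀ h1 h3]
  have e1 : Real.exp (-(y + ρ)) = Real.exp (-y) * Real.exp (-ρ) := by rw [← Real.exp_add]; ring_nf
  have e2 : Real.exp (-y) * Real.exp y = 1 := by rw [← Real.exp_add]; simp
  have e3 := Real.add_one_le_exp (-ρ)
  have : (1 - Real.exp (-(y + ρ)) - (1 - Real.exp (-y))) * (Real.exp y - 1) =
      (1 - Real.exp (-ρ)) * (1 - Real.exp (-y)) := by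
    rw [e1]
    linear_combination (1 - Real.exp (-ρ)) * e2
  rw [this]
  gcongr
  linarith

lemma variancePotential_le_div {T x : ℝ} (hx : 0 < x) (hT : 0 ≤ T) :
    variancePotential T x ≤ Real.log ((x + T) / x) := by
  have h1 := one_sub_exp_neg_pos hx
  have h2 := one_sub_exp_neg_pos (show 0 < x + T by linarith)
  unfold variancePotential
  rw [← Real.log_div h2.ne' h1.ne']
  apply Real.log_le_log (div_pos h2 h1)
  rw [div_le_div_iff₀ h1 hx]
  have e1 : Real.exp (-(x + T)) = Real.exp (-x) * Real.exp (-T) := by rw [← Real.exp_add]; ring_nf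
  have e2 := Real.add_one_le_exp (-T)
  have e3 : Real.exp (-x) * (1 + x) ≤ 1 := by
    have := Real.add_one_le_exp x
    calc Real.exp (-x) * (1 + x) ≤ Real.exp (-x) * Real.exp x := by gcongr; linarith
      _ = 1 := by rw [← Real.exp_add]; simp
  rw [e1]
  have e4 := Real.exp_pos (-x)
  nlinarith [mul_nonneg hT (sub_nonneg.2 e3), mul_nonneg (mul_nonneg hx.le e4.le) (sub_nonneg.2 e2)]

lemma variancePotential_nonneg {T x : ℝ} (hx : 0 < x) (hT : 0 ≤ T) :
    0 ≤ variancePotential T x := by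
  unfold variancePotential
  rw [sub_nonneg]
  apply Real.log_le_log (one_sub_exp_neg_pos hx)
  have : Real.exp (-(x + T)) ≤ Real.exp (-x) := Real.exp_le_exp.2 (by linarith)
  linarith

lemma variancePotential_mono {S T x : ℝ} (hx : 0 < x) (hS : 0 ≤ S) (hST : S ≤ T) :
    variancePotential S x ≤ variancePotential T x := by
  unfold variancePotential
  gcongr
  exact one_sub_exp_neg_pos (by linarith)

lemma variancePotential_le_neg_log {T x : ℝ} (hx : 0 < x) (hT : 0 ≤ T) :
    variancePotential T x ≤ -Real.log (1 - Real.exp (-x)) := by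
  have : Real.log (1 - Real.exp (-(x + T))) ≤ 0 :=
    Real.log_nonpos (one_sub_exp_neg_pos (by linarith)).le (by linarith [Real.exp_pos (-(x + T))])
  unfold variancePotential
  linarith

/-- The constant comparing `1 / (e^x - 1)` before and after one jump. -/
noncomputable def jumpConst : ℝ := 11 * Real.exp 10

lemma exp_add_sub_one_le {x u : ℝ} (hx : 0 < x) (h1 : u ≤ 10 * x)
    (h2 : 1 ≤ x → u ≤ 10) : Real.exp (x + u) - 1 ≤ jumpConst * (Real.exp x - 1) := by
  have hex := exp_sub_one_pos hx
  have hu10 : u ≤ 10 := by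
    rcases le_total 1 x with h | h
    · exact h2 h
    · linarith
  have h3 : Real.exp u ≤ Real.exp 10 := Real.exp_le_exp.2 hu10
  have h4 : Real.exp u - 1 ≤ u * Real.exp u := by
    have := Real.add_one_le_exp (-u)
    have h5 : Real.exp (-u) * Real.exp u = 1 := by rw [← Real.exp_add]; simp
    nlinarith [Real.exp_pos u]
  have h6 : x ≤ Real.exp x - 1 := by linarith [Real.add_one_le_exp x]
  have h7 : u * Real.exp u ≤ 10 * Real.exp 10 * (Real.exp x - 1) := by
    calc u * Real.exp u ≤ (10 * x) * Real.exp 10 := by gcongr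
      _ = 10 * Real.exp 10 * x := by ring
      _ ≤ 10 * Real.exp 10 * (Real.exp x - 1) := by gcongr
  have h8 : Real.exp u * (Real.exp x - 1) ≤ Real.exp 10 * (Real.exp x - 1) := by gcongr
  rw [Real.exp_add]
  unfold jumpConst
  linarith

/-- The potential decreases along a jump, up to a centred term. -/
lemma variancePotential_jump {T a x ρ : ℝ} (hT : 0 ≤ T) (ha : 0 ≤ a) (hx : 0 < x)
    (hρ : -a ≤ ρ) (h1 : a + ρ ≤ 10 * x) (h2 : 1 ≤ x → a + ρ ≤ 10) :
    variancePotential T (x + (a + ρ)) ≤ variancePotential (T + a) x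
      + ρ / (Real.exp (x + (T + a)) - 1) - (a + ρ) / (jumpConst * (Real.exp x - 1)) := by
  have hu : 0 ≤ a + ρ := by linarith
  -- The upper endpoint moves by `ρ` only, because the remaining time drops by `a`: its tangent term
  -- is linear in `ρ`, hence centred. At the lower endpoint the tangent is taken at the new
  -- position, which gives the gain; `jumpConst` refers its slope back to `x`.
  have e1 := log_one_sub_exp_neg_sub_le (y := x + (T + a)) (ρ := ρ) (by linarith) (by linarith)
  have e2 := log_one_sub_exp_neg_sub_le (y := x + (a + ρ)) (ρ := -(a + ρ)) (by linarith)
    (by linarith)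
  have e3 : (a + ρ) / (jumpConst * (Real.exp x - 1)) ≤ (a + ρ) / (Real.exp (x + (a + ρ)) - 1) :=
    div_le_div_of_nonneg_left hu (exp_sub_one_pos (by linarith)) (exp_add_sub_one_le hx h1 h2)
  rw [neg_div, show x + (a + ρ) + -(a + ρ) = x by ring] at e2
  unfold variancePotential
  rw [show x + (a + ρ) + T = x + (T + a) + ρ by ring]
  linarith

/-! ### Exponential moments of one slit-map jump. -/

/-- The displacement of a rotated slit map in logarithmic coordinates, minus its mean. -/
noncomputable def slitFluct (a : ℝ) (z : ℂ) (t : ℝ) : ℂ := logRotSlitMap a t z - z - a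

lemma measurable_slitMap (c : ℝ) : Measurable (slitMap c) := by
  unfold slitMap halfPlaneSlit cayley
  fun_prop

lemma measurable_logSlitMap (c : ℝ) : Measurable (logSlitMap c) := by
  unfold logSlitMap
  have := measurable_slitMap c
  fun_prop

lemma measurable_logRotSlitMap (c : ℝ) :
    Measurable (fun p : ℝ × ℂ => logRotSlitMap c p.1 p.2) := by
  unfold logRotSlitMap
  have := measurable_logSlitMap c
  fun_prop

lemma measurable_slitFluct (a : ℝ) (z : ℂ) : Measurable (slitFluct a z) := by
  unfold slitFluct
  have h : Measurable fun t : ℝ => logRotSlitMap a t z :=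
    (measurable_logRotSlitMap a).comp (measurable_id.prodMk measurable_const)
  exact (h.sub_const _).sub_const _

lemma exists_slitFluct_eq {a : ℝ} (ha : 0 ≤ a) : ∃ k : ℂ → ℂ, DifferentiableOn ℂ k (ball 0 1) ∧
    k 0 = 0 ∧ ∀ z t, slitFluct a z t = k (Complex.exp (-z) * Complex.exp (t * Complex.I)) := by
  obtain ⟨k, hd, h0, hkz, -⟩ := (isLogMap_logSlitMap ha).exists_herglotz
  refine ⟨fun w => k w - a, hd.sub_const _, by simp [h0], fun z t => ?_⟩
  have h1 := hkz (z - t * Complex.I)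
  rw [neg_sub, sub_eq_neg_add, Complex.exp_add] at h1
  simp only [h1, slitFluct, logRotSlitMap]
  ring

lemma integral_slitFluct {a : ℝ} (ha : 0 ≤ a) {z : ℂ} (hz : 0 < z.re) :
    ∫ t, slitFluct a z t ∂uniformAngle = 0 := by
  obtain ⟨k, hd, h0, hk⟩ := exists_slitFluct_eq ha
  simp_rw [hk]
  rw [integral_uniformAngle hd (exp_neg_mem_ball hz), h0]

/-- The square of the centred displacement is again holomorphic in the disk variable and vanishes at
the centre. The real and imaginary parts therefore have equal variance, which lets the one-sided
bound on the real part control both. -/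
lemma integral_slitFluct_sq {a : ℝ} (ha : 0 ≤ a) {z : ℂ} (hz : 0 < z.re) :
    ∫ t, slitFluct a z t ^ 2 ∂uniformAngle = 0 := by
  obtain ⟨k, hd, h0, hk⟩ := exists_slitFluct_eq ha
  simp_rw [hk]
  rw [integral_uniformAngle (φ := fun w => k w ^ 2) (hd.pow 2) (exp_neg_mem_ball hz), h0]
  simp

lemma norm_slitFluct_le {a : ℝ} (ha : 0 ≤ a) {z : ℂ} (hz : 0 < z.re) (t : ℝ) :
    ‖slitFluct a z t‖ ≤ 2 * a * (1 / (Real.exp z.re - 1)) := by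
  have h := (isLogMap_logSlitMap ha).norm_sub_le (z := z - t * Complex.I) (by simpa using hz)
  have h1 : slitFluct a z t = logSlitMap a (z - t * Complex.I) - (z - t * Complex.I) - a := by
    rw [slitFluct, logRotSlitMap]
    ring
  rw [h1, mul_one_div]
  simpa using h

lemma neg_le_re_slitFluct {a : ℝ} (ha : 0 ≤ a) {z : ℂ} (hz : 0 < z.re) (t : ℝ) :
    -a ≤ (slitFluct a z t).re := by
  have h := (isLogMap_logSlitMap ha).re_le (z := z - t * Complex.I) (by simpa using hz)
  simp [slitFluct, logRotSlitMap] at h ⊢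
  linarith

/-- Exponential moments of one jump, tilted by the potential. -/
lemma integral_exp_slitFluct_le {a c s T κ ℓ : ℝ} (ha : 0 ≤ a) (hac : a ≤ c) (hc1 : c ≤ 1)
    (hs : 0 < s) (hcs : c ≤ (2 * s) ^ 3) (hT : 0 ≤ T) (hℓ : 0 ≤ ℓ)
    (hℓs : ℓ * c * (16 * jumpConst) ≤ s) (hκ : κ = ℓ ^ 2 * c * (16 * jumpConst))
    {lam : ℂ} (hlam : ‖lam‖ = ℓ) {z : ℂ} (hz : s ≤ z.re) :
    ∫⁻ t, ENNReal.ofReal (Real.exp ((lam * slitFluct a z t).re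
        + κ * variancePotential T (logRotSlitMap a t z).re)) ∂uniformAngle
      ≤ ENNReal.ofReal (Real.exp (κ * variancePotential (T + a) z.re)) := by
  have hx : 0 < z.re := by linarith
  obtain ⟨x, hxdef⟩ : ∃ x, x = z.re := ⟨_, rfl⟩
  rw [← hxdef] at hx hz ⊢
  have hc0 : 0 ≤ c := ha.trans hac
  have hC : 1 ≤ jumpConst := by
    unfold jumpConst
    linarith [Real.add_one_le_exp 10]
  have hE := exp_sub_one_pos hx
  have hxE : x ≤ Real.exp x - 1 := by linarith [Real.add_one_le_exp x]
  obtain ⟨b, hb⟩ : ∃ b, b = 1 / (Real.exp x - 1) := ⟨_, rfl⟩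
  have hb0 : 0 < b := by rw [hb]; positivity
  have hbx : b * x ≤ 1 := by rw [hb, one_div, inv_mul_le_iff₀ hE]; linarith
  have hξ : ∀ t, ‖slitFluct a z t‖ ≤ 2 * a * b := fun t => by
    rw [hb, hxdef]; exact norm_slitFluct_le ha (hxdef ▸ hx) t
  have hre : ∀ t, -a ≤ (slitFluct a z t).re := neg_le_re_slitFluct ha (hxdef ▸ hx)
  -- The cubic condition on `c`, with `c ≤ 1`, enters only through these two bounds. They limit a
  -- jump, which is at most `a + 2cb ≤ c + 2c/x`, to `10x`, as the comparison constant requires.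
  have hcx : c ≤ 2 * x ∧ c ≤ 4 * x ^ 2 := by
    rcases le_total (2 * x) 1 with h | h
    · have h1 : (2 * s) ^ 3 ≤ (2 * x) ^ 3 := by gcongr
      have h2 : (2 * x) ^ 3 ≤ (2 * x) ^ 2 := pow_le_pow_of_le_one (by linarith) h (by norm_num)
      have h3 : (2 * x) ^ 2 ≤ 2 * x := by nlinarith
      constructor <;> nlinarith
    · constructor <;> nlinarith
  have hjump : ∀ t, a + (slitFluct a z t).re ≤ 10 * x ∧
      (1 ≤ x → a + (slitFluct a z t).re ≤ 10) := by
    intro t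
    have h1 := (Complex.re_le_norm _).trans (hξ t)
    have h2 : 2 * a * b ≤ 2 * c * b := by gcongr
    have h3 : 2 * c * b ≤ 8 * x := by nlinarith
    refine ⟨by linarith [hcx.1], fun h => ?_⟩
    have : b ≤ 1 := by nlinarith
    nlinarith
  set q := 1 / (Real.exp (x + (T + a)) - 1) with hq
  have hq0 : 0 ≤ q := by
    have := exp_sub_one_pos (show 0 < x + (T + a) by linarith)
    positivity
  have hqb : q ≤ b := by
    rw [hq, hb]
    apply one_div_le_one_div_of_le hE
    have : Real.exp x ≤ Real.exp (x + (T + a)) := Real.exp_le_exp.2 (by linarith)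
    linarith
  have hκ0 : 0 ≤ κ := by rw [hκ]; positivity
  -- The terms of the potential that are linear in `Re ξ` are absorbed into the tilt, so one moment
  -- estimate treats both.
  set μ : ℂ := lam + (κ * (q - b / jumpConst) : ℝ) with hμ
  have hbC : b / jumpConst ≤ b := div_le_self hb0.le hC
  have hbC0 : 0 ≤ b / jumpConst := by positivity
  -- The absorbed part is no larger than the original tilt; this is where `ℓ * c * (16 * jumpConst)
  -- ≤ s` is needed.
  have hκb : κ * b ≤ ℓ := by
    have h1 : κ * b = ℓ * (ℓ * c * (16 * jumpConst)) * b := by rw [hκ]; ring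
    rw [h1, mul_assoc]
    apply mul_le_of_le_one_right hℓ
    calc ℓ * c * (16 * jumpConst) * b ≤ x * b := by gcongr; linarith
      _ ≤ 1 := by linarith
  have hμn : ‖μ‖ ≤ 2 * ℓ := by
    have h1 : ‖((κ * (q - b / jumpConst) : ℝ) : ℂ)‖ ≤ κ * b := by
      rw [Complex.norm_real, Real.norm_eq_abs, abs_mul, abs_of_nonneg hκ0]
      gcongr
      rw [abs_le]
      constructor <;> linarith
    calc ‖μ‖ ≤ ‖lam‖ + ‖((κ * (q - b / jumpConst) : ℝ) : ℂ)‖ := norm_add_le _ _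
      _ ≤ 2 * ℓ := by linarith
  have hμ1 : ‖μ‖ * (2 * a * b) ≤ 1 := by
    have h1 : ℓ * c * 16 ≤ s := by
      refine le_trans ?_ hℓs
      gcongr
      linarith
    calc ‖μ‖ * (2 * a * b) ≤ (2 * ℓ) * (2 * c * b) := by gcongr
      _ = 4 * (ℓ * c) * b := by ring
      _ ≤ x * b := by gcongr; nlinarith
      _ ≤ 1 := by linarith
  have hmgf := integral_exp_re_le (measurable_slitFluct a z) hξ hre
    (integral_slitFluct ha (hxdef ▸ hx)) (integral_slitFluct_sq ha (hxdef ▸ hx)) μ hμ1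
  have hpt : ∀ t, (lam * slitFluct a z t).re
        + κ * variancePotential T (logRotSlitMap a t z).re ≤
      (κ * variancePotential (T + a) x - κ * a * (b / jumpConst)) + (μ * slitFluct a z t).re := by
    intro t
    have h1 : (logRotSlitMap a t z).re = x + (a + (slitFluct a z t).re) := by
      rw [hxdef]
      simp [slitFluct]
    have h2 := variancePotential_jump hT ha hx (hre t) (hjump t).1 (hjump t).2
    have h3 : (μ * slitFluct a z t).re = (lam * slitFluct a z t).re
        + κ * (q - b / jumpConst) * (slitFluct a z t).re := by
      rw [hμ, add_mul, Complex.add_re, Complex.re_ofReal_mul]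
    have h4 : (slitFluct a z t).re / (Real.exp (x + (T + a)) - 1) = (slitFluct a z t).re * q := by
      rw [hq]; ring
    have h5 : (a + (slitFluct a z t).re) / (jumpConst * (Real.exp x - 1)) =
        (a + (slitFluct a z t).re) * (b / jumpConst) := by
      rw [hb]
      field_simp
    rw [h4, h5] at h2
    rw [h1, h3]
    have h6 := mul_le_mul_of_nonneg_left h2 hκ0
    linarith
  have hint : Integrable (fun t => Real.exp (μ * slitFluct a z t).re) uniformAngle := by
    refine Integrable.of_bound ?_ (Real.exp 1) (Eventually.of_forall fun t => ?_)
    · exact (Real.measurable_exp.comp (Complex.measurable_re.comp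
        ((measurable_slitFluct a z).const_mul μ))).aestronglyMeasurable
    · rw [Real.norm_eq_abs, Real.abs_exp, Real.exp_le_exp]
      refine (Complex.re_le_norm _).trans ?_
      rw [norm_mul]
      exact (mul_le_mul_of_nonneg_left (hξ t) (norm_nonneg _)).trans hμ1
  set K := κ * variancePotential (T + a) x - κ * a * (b / jumpConst) with hK
  calc ∫⁻ t, ENNReal.ofReal (Real.exp ((lam * slitFluct a z t).re
        + κ * variancePotential T (logRotSlitMap a t z).re)) ∂uniformAngle
      ≤ ∫⁻ t, ENNReal.ofReal (Real.exp K * Real.exp (μ * slitFluct a z t).re) ∂uniformAngle := by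
        apply lintegral_mono
        intro t
        apply ENNReal.ofReal_le_ofReal
        rw [← Real.exp_add]
        exact Real.exp_le_exp.2 (hpt t)
    _ = ENNReal.ofReal (∫ t, Real.exp K * Real.exp (μ * slitFluct a z t).re ∂uniformAngle) := by
        rw [ofReal_integral_eq_lintegral_ofReal (hint.const_mul _)
          (Eventually.of_forall fun t => by positivity)]
    _ ≤ _ := by
        apply ENNReal.ofReal_le_ofReal
        rw [integral_const_mul]
        calc Real.exp K * ∫ t, Real.exp (μ * slitFluct a z t).re ∂uniformAngle
            ≤ Real.exp K * Real.exp (4 * ‖μ‖ ^ 2 * a ^ 2 * b) := by gcongr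
          _ ≤ _ := by
            rw [← Real.exp_add, Real.exp_le_exp]
            have h1 : 4 * ‖μ‖ ^ 2 * a ^ 2 * b ≤ 4 * (2 * ℓ) ^ 2 * (a * c) * b := by
              rw [pow_two a]
              gcongr
            -- The factor `16 * jumpConst` in `κ` is chosen so that the loss of potential exactly
            -- pays for the variance when `‖μ‖ ≤ 2ℓ` and `a ≤ c`.
            have h2 : κ * a * (b / jumpConst) = 4 * (2 * ℓ) ^ 2 * (a * c) * b := by
              rw [hκ]
              field_simp
              ring
            linarith

/-! ### Exponential moments of the cluster map at a fixed point. -/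

lemma measurable_logClusterMap (c : ℕ → ℝ) (n : ℕ) :
    Measurable (fun p : (ℕ → ℝ) × ℂ => logClusterMap c p.1 n p.2) := by
  induction n with
  | zero => exact measurable_snd
  | succ n ih =>
    have h1 : Measurable fun p : (ℕ → ℝ) × ℂ => logRotSlitMap (c n) (p.1 n) p.2 :=
      (measurable_logRotSlitMap (c n)).comp
        (g := fun q : ℝ × ℂ => logRotSlitMap (c n) q.1 q.2)
        (f := fun p : (ℕ → ℝ) × ℂ => (p.1 n, p.2)) (by fun_prop)
    exact ih.comp (measurable_fst.prodMk h1)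

lemma logClusterMap_congr (c : ℕ → ℝ) {θ θ' : ℕ → ℝ} {n : ℕ} (h : ∀ i < n, θ i = θ' i) (z : ℂ) :
    logClusterMap c θ n z = logClusterMap c θ' n z := by
  induction n generalizing z with
  | zero => rfl
  | succ n ih =>
    simp only [logClusterMap, Function.comp_apply]
    rw [h n (Nat.lt_succ_self n), ih fun i hi => h i (hi.trans (Nat.lt_succ_self n))]

/-- The deviation `Φ̃_n(z) - z - C_n`. -/
noncomputable def clusterFluct (c θ : ℕ → ℝ) (n : ℕ) (z : ℂ) : ℂ :=
  logClusterMap c θ n z - z - totalCap c n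

/-- The newest particle acts first, so the recursion runs backwards: after conditioning on the last
angle, the earlier map is evaluated at a fixed displaced point. -/
lemma clusterFluct_succ (c θ : ℕ → ℝ) (n : ℕ) (z : ℂ) :
    clusterFluct c θ (n + 1) z =
      clusterFluct c θ n (logRotSlitMap (c n) (θ n) z) + slitFluct (c n) z (θ n) := by
  simp only [clusterFluct, slitFluct, logClusterMap, Function.comp_apply, totalCap,
    Finset.sum_range_succ]
  push_cast
  ring

lemma measurable_clusterFluct (c : ℕ → ℝ) (n : ℕ) :
    Measurable (fun p : (ℕ → ℝ) × ℂ => clusterFluct c p.1 n p.2) :=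
  ((measurable_logClusterMap c n).sub measurable_snd).sub_const _

lemma totalCap_nonneg {c : ℕ → ℝ} (hc : ∀ k, 0 ≤ c k) (n : ℕ) : 0 ≤ totalCap c n :=
  Finset.sum_nonneg fun k _ => hc k

section Probability

variable {Ω : Type*} [MeasurableSpace Ω] {P : Measure Ω} [IsProbabilityMeasure P] {θ : ℕ → Ω → ℝ}

/-- The expectation of a function of the first `n` angles and of the next one. -/
lemma lintegral_angles_succ (hm : ∀ k, Measurable (θ k)) (hi : iIndepFun θ P)
    (hu : ∀ k, pdf.IsUniform (θ k) (Set.Ico 0 (2 * Real.pi)) P) (n : ℕ)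
    {F : (ℕ → ℝ) → ℝ → ENNReal} (hF : Measurable (Function.uncurry F))
    (hFn : ∀ θ₁ θ₂ : ℕ → ℝ, (∀ i < n, θ₁ i = θ₂ i) → F θ₁ = F θ₂) :
    ∫⁻ ω, F (fun k => θ k ω) (θ n ω) ∂P =
      ∫⁻ t, ∫⁻ ω, F (fun k => θ k ω) t ∂P ∂uniformAngle := by
  -- The past is cut to its first `n` angles and padded by zeros, which `F` does not see;
  -- finite-block independence from the next angle then applies.
  set ext : (Finset.range n → ℝ) → ℕ → ℝ :=
    fun v k => if hk : k ∈ Finset.range n then v ⟨k, hk⟩ else 0 with hext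
  have mext : Measurable ext := by
    refine measurable_pi_lambda _ fun k => ?_
    by_cases hk : k ∈ Finset.range n
    · simpa only [hext, hk, dif_pos] using measurable_pi_apply _
    · simp only [hext, hk, dif_neg, not_false_iff]
      exact measurable_const
  set past : Ω → ℕ → ℝ := fun ω => ext (fun i => θ i ω) with hpast
  have mpast : Measurable past := mext.comp (measurable_pi_lambda _ fun i => hm i)
  have hFp : ∀ ω, F (fun k => θ k ω) = F (past ω) := fun ω => by
    apply hFn
    intro i hin
    simp [hpast, hext, hin]
  have hind : IndepFun past (θ n) P := by
    have h1 := hi.indepFun_finset (Finset.range n) {n} (by simp) hm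
    exact h1.comp mext (measurable_pi_apply (⟨n, by simp⟩ : ({n} : Finset ℕ)))
  have hlaw : P.map (θ n) = uniformAngle := hu n
  have hmap := (indepFun_iff_map_prod_eq_prod_map_map mpast.aemeasurable
    (hm n).aemeasurable).1 hind
  rw [hlaw] at hmap
  have : IsProbabilityMeasure (P.map past) := Measure.isProbabilityMeasure_map mpast.aemeasurable
  calc ∫⁻ ω, F (fun k => θ k ω) (θ n ω) ∂P
      = ∫⁻ ω, Function.uncurry F (past ω, θ n ω) ∂P := by simp_rw [hFp]; rfl
    _ = ∫⁻ p, Function.uncurry F p ∂((P.map past).prod uniformAngle) := by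
        rw [← hmap, lintegral_map hF (mpast.prodMk (hm n))]
    _ = ∫⁻ t, ∫⁻ v, F v t ∂(P.map past) ∂uniformAngle := by
        rw [lintegral_prod_symm' _ hF]
        rfl
    _ = _ := by
        refine lintegral_congr fun t => ?_
        rw [lintegral_map (f := fun v => F v t)
          (hF.comp (measurable_id.prodMk measurable_const)) mpast]
        simp_rw [hFp]

/-- Exponential moments of the deviation at a fixed point. -/
lemma lintegral_exp_clusterFluct_le (hm : ∀ k, Measurable (θ k)) (hi : iIndepFun θ P)
    (hu : ∀ k, pdf.IsUniform (θ k) (Set.Ico 0 (2 * Real.pi)) P)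
    {c : ℕ → ℝ} {cmax s κ ℓ : ℝ} (hc : ∀ k, 0 ≤ c k) (hcm : ∀ k, c k ≤ cmax) (hc1 : cmax ≤ 1)
    (hs : 0 < s) (hcs : cmax ≤ (2 * s) ^ 3) (hℓ : 0 ≤ ℓ)
    (hℓs : ℓ * cmax * (16 * jumpConst) ≤ s) (hκ : κ = ℓ ^ 2 * cmax * (16 * jumpConst))
    {lam : ℂ} (hlam : ‖lam‖ = ℓ) (n : ℕ) {z : ℂ} (hz : s ≤ z.re) :
    ∫⁻ ω, ENNReal.ofReal (Real.exp (lam * clusterFluct c (fun k => θ k ω) n z).re) ∂P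
      ≤ ENNReal.ofReal (Real.exp (κ * variancePotential (totalCap c n) z.re)) := by
  induction n generalizing z with
  | zero => simp [clusterFluct, logClusterMap, totalCap, variancePotential]
  | succ n ih =>
    have hz0 : 0 < z.re := by linarith
    set F : (ℕ → ℝ) → ℝ → ENNReal := fun v t => ENNReal.ofReal (Real.exp
      (lam * (clusterFluct c v n (logRotSlitMap (c n) t z) + slitFluct (c n) z t)).re) with hFdef
    have hrot : Measurable fun t : ℝ => logRotSlitMap (c n) t z :=
      (measurable_logRotSlitMap (c n)).comp (measurable_id.prodMk measurable_const)
    have hF : Measurable (Function.uncurry F) := by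
      have h1 : Measurable fun p : (ℕ → ℝ) × ℝ =>
          clusterFluct c p.1 n (logRotSlitMap (c n) p.2 z) :=
        (measurable_clusterFluct c n).comp
          (measurable_fst.prodMk (hrot.comp measurable_snd))
      have h2 : Measurable fun p : (ℕ → ℝ) × ℝ => slitFluct (c n) z p.2 :=
        (measurable_slitFluct (c n) z).comp measurable_snd
      exact ENNReal.measurable_ofReal.comp (Real.measurable_exp.comp
        (Complex.measurable_re.comp ((h1.add h2).const_mul lam)))
    have hFn : ∀ θ₁ θ₂ : ℕ → ℝ, (∀ i < n, θ₁ i = θ₂ i) → F θ₁ = F θ₂ := by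
      intro θ₁ θ₂ h
      ext t
      simp only [hFdef, clusterFluct, logClusterMap_congr c h]
    have h1 := lintegral_angles_succ hm hi hu n hF hFn
    have h2 : ∀ ω, ENNReal.ofReal (Real.exp (lam * clusterFluct c (fun k => θ k ω) (n + 1) z).re)
        = F (fun k => θ k ω) (θ n ω) := fun ω => by
      rw [clusterFluct_succ]
    simp_rw [h2]
    rw [h1]
    -- With the last angle frozen at `t`, the induction hypothesis is used at the displaced point,
    -- which still lies to the right of `s`.
    have h3 : ∀ t, ∫⁻ ω, F (fun k => θ k ω) t ∂P ≤ ENNReal.ofReal (Real.exp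
        ((lam * slitFluct (c n) z t).re
          + κ * variancePotential (totalCap c n) (logRotSlitMap (c n) t z).re)) := by
      intro t
      have hre : s ≤ (logRotSlitMap (c n) t z).re := by
        have h4 := neg_le_re_slitFluct (hc n) hz0 t
        simp only [slitFluct, Complex.sub_re, Complex.ofReal_re] at h4
        linarith
      have h5 : ∀ ω, F (fun k => θ k ω) t = ENNReal.ofReal (Real.exp
          (lam * slitFluct (c n) z t).re) * ENNReal.ofReal (Real.exp
          (lam * clusterFluct c (fun k => θ k ω) n (logRotSlitMap (c n) t z)).re) := fun ω => by
        rw [← ENNReal.ofReal_mul (Real.exp_pos _).le, ← Real.exp_add]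
        simp only [hFdef, mul_add, Complex.add_re]
        rw [add_comm]
      simp_rw [h5]
      rw [lintegral_const_mul' _ _ ENNReal.ofReal_ne_top, Real.exp_add,
        ENNReal.ofReal_mul (Real.exp_pos _).le]
      gcongr
      exact ih hre
    refine (lintegral_mono h3).trans ?_
    have h6 : totalCap c (n + 1) = totalCap c n + c n := Finset.sum_range_succ _ _
    rw [h6]
    exact integral_exp_slitFluct_le (hc n) (hcm n) hc1 hs hcs (totalCap_nonneg hc n) hℓ hℓs hκ
      hlam hz

end Probability

/-! ### Uniformity over the half-plane. -/

/-- A holomorphic function in the disk of radius `e^{-2s}` is bounded by its mean over the circle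
of radius `e^{-s}`. -/
lemma enorm_le_lintegral_circle {F : ℂ → ℂ} (hF : DifferentiableOn ℂ F (ball 0 1)) {s : ℝ}
    (hs : 0 < s) {w : ℂ} (hw : ‖w‖ ≤ Real.exp (-(2 * s))) :
    ‖F w‖ₑ ≤ ENNReal.ofReal (1 / (1 - Real.exp (-s))) *
      ∫⁻ t : ℝ, ‖F (Real.exp (-s) * Complex.exp (t * Complex.I))‖ₑ ∂uniformAngle := by
  set r := Real.exp (-s) with hr
  have hr0 : 0 < r := Real.exp_pos _
  have hr1 : r < 1 := Real.exp_lt_one_iff.2 (by linarith)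
  have hwr : ‖w‖ ≤ r * r := by
    rw [hr, ← Real.exp_add]
    convert hw using 2
    ring
  have hd : DiffContOnCl ℂ F (ball 0 |r|) := by
    apply DifferentiableOn.diffContOnCl
    rw [abs_of_pos hr0, closure_ball _ hr0.ne']
    exact hF.mono (closedBall_subset_ball hr1)
  -- Cauchy's formula with kernel `v/(v - w)`; for `|v| = r` and `|w| ≤ r²` the kernel is at most
  -- `r/(r - r²) = 1/(1 - r)`.
  have h1 := hd.circleAverage_smul_div (w := w) (by
    rw [mem_ball_zero_iff, abs_of_pos hr0]
    nlinarith)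
  rw [circleAverage_eq_integral_uniformAngle] at h1
  rw [← h1, ← lintegral_const_mul' _ _ ENNReal.ofReal_ne_top]
  refine (enorm_integral_le_lintegral_enorm _).trans (lintegral_mono fun t => ?_)
  rw [smul_eq_mul, enorm_mul]
  gcongr
  rw [sub_zero, ← ofReal_norm]
  apply ENNReal.ofReal_le_ofReal
  have hv : ‖(r : ℂ) * Complex.exp (t * Complex.I)‖ = r := by
    rw [norm_mul, Complex.norm_exp_ofReal_mul_I, Complex.norm_real, Real.norm_eq_abs,
      abs_of_pos hr0, mul_one]
  have h2 : r - r * r ≤ ‖(r : ℂ) * Complex.exp (t * Complex.I) - w‖ := by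
    have := norm_sub_norm_le ((r : ℂ) * Complex.exp (t * Complex.I)) w
    rw [hv] at this
    linarith
  rw [norm_div, hv, div_le_div_iff₀ (by nlinarith) (by linarith)]
  linarith

/-- Cauchy's formula for the holomorphic function `exp(λ(k - T))` of `e^{-z}`. The right side
depends only on the vertical line at distance `s` and not on `z`, so the supremum over `z` is taken
before the expectation. -/
lemma IsLogMap.exp_re_le_lintegral {H : ℂ → ℂ} {T : ℝ} (h : IsLogMap H T) (lam : ℂ) {s : ℝ}
    (hs : 0 < s) {z : ℂ} (hz : 2 * s ≤ z.re) :
    ENNReal.ofReal (Real.exp (lam * (H z - z - T)).re) ≤ ENNReal.ofReal (1 / (1 - Real.exp (-s))) *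
      ∫⁻ t : ℝ, ENNReal.ofReal (Real.exp (lam * (H (s - t * Complex.I) - (s - t * Complex.I) - T)).re)
        ∂uniformAngle := by
  obtain ⟨k, hd, -, hkz, -⟩ := h.exists_herglotz
  have h1 := enorm_le_lintegral_circle (F := fun w => Complex.exp (lam * (k w - T)))
    (((hd.sub_const _).const_mul _).cexp) hs (w := Complex.exp (-z)) (by
      rw [Complex.norm_exp, Real.exp_le_exp, Complex.neg_re]
      linarith)
  have h2 : ∀ t : ℝ, (Real.exp (-s) : ℂ) * Complex.exp (t * Complex.I) =
      Complex.exp (-(s - t * Complex.I)) := fun t => by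
    rw [Complex.ofReal_exp, ← Complex.exp_add]
    congr 1
    push_cast
    ring
  simp_rw [h2, hkz, ← ofReal_norm, Complex.norm_exp] at h1
  exact h1

/-- Otherwise both coordinates are below `ε/3` in modulus, while `2/9 < 1/4`. Four tilt directions
thus detect any large deviation. -/
lemma exists_pow_I_re_ge {w : ℂ} {ε : ℝ} (hε : 0 < ε) (hw : ε / 2 ≤ ‖w‖) :
    ∃ j ∈ Finset.range 4, ε / 3 ≤ (Complex.I ^ j * w).re := by
  by_contra hn
  push Not at hn
  have h0 := hn 0 (by simp)
  have h1 := hn 1 (by simp)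
  have h2 := hn 2 (by simp)
  have h3 := hn 3 (by simp)
  simp [pow_succ] at h0 h1 h2 h3
  have h4 : (ε / 2) ^ 2 ≤ w.re * w.re + w.im * w.im := by
    rw [← Complex.normSq_apply, Complex.normSq_eq_norm_sq]
    gcongr
  have h5 : w.re * w.re ≤ (ε / 3) ^ 2 := by nlinarith
  have h6 : w.im * w.im ≤ (ε / 3) ^ 2 := by nlinarith
  nlinarith [pow_pos hε 2]

/-- Probability of a large deviation at time `n`, uniformly in the half-plane. -/
lemma measure_clusterFluct_ge_le {Ω : Type*} [MeasurableSpace Ω] {P : Measure Ω}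
    [IsProbabilityMeasure P] {θ : ℕ → Ω → ℝ} (hm : ∀ k, Measurable (θ k)) (hi : iIndepFun θ P)
    (hu : ∀ k, pdf.IsUniform (θ k) (Set.Ico 0 (2 * Real.pi)) P)
    {c : ℕ → ℝ} {cmax s κ ℓ ε : ℝ} (hc : ∀ k, 0 ≤ c k) (hcm : ∀ k, c k ≤ cmax) (hc1 : cmax ≤ 1)
    (hs : 0 < s) (hcs : cmax ≤ (2 * s) ^ 3) (hℓ : 0 ≤ ℓ)
    (hℓs : ℓ * cmax * (16 * jumpConst) ≤ s) (hκ : κ = ℓ ^ 2 * cmax * (16 * jumpConst))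
    (hε : 0 < ε) (n : ℕ) :
    P {ω | ∃ z : ℂ, 2 * s < z.re ∧ ε / 2 ≤ ‖clusterFluct c (fun k => θ k ω) n z‖} ≤
      ENNReal.ofReal (4 / (1 - Real.exp (-s)) *
        Real.exp (κ * variancePotential (totalCap c n) s - ℓ * ε / 3)) := by
  set lam : ℕ → ℂ := fun j => ℓ * Complex.I ^ j with hlamdef
  have hlam : ∀ j, ‖lam j‖ = ℓ := fun j => by simp [hlamdef, abs_of_nonneg hℓ]
  set g : ℕ → (ℕ → ℝ) × ℝ → ENNReal := fun j p => ENNReal.ofReal (Real.exp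
    (lam j * clusterFluct c p.1 n (s - p.2 * Complex.I)).re) with hgdef
  have hg : ∀ j, Measurable (g j) := fun j => by
    have h1 : Measurable fun p : (ℕ → ℝ) × ℝ => clusterFluct c p.1 n (s - p.2 * Complex.I) :=
      (measurable_clusterFluct c n).comp (measurable_fst.prodMk (by fun_prop))
    exact ENNReal.measurable_ofReal.comp (Real.measurable_exp.comp
        (Complex.measurable_re.comp (h1.const_mul _)))
  have hθ : Measurable fun ω => fun k => θ k ω := measurable_pi_lambda _ hm
  -- The random circle mean that dominates all points at once. Tonelli reduces its expectation to
  -- the fixed-point bound, and Markov's inequality is applied to it.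
  set A : ℕ → Ω → ENNReal := fun j ω => ∫⁻ t, g j (fun k => θ k ω, t) ∂uniformAngle with hAdef
  have hA : ∀ j, Measurable (A j) := fun j =>
    (Measurable.lintegral_prod_right' (hg j)).comp hθ
  set D := 1 / (1 - Real.exp (-s)) with hD
  have hD0 : 0 < D := by
    have := one_sub_exp_neg_pos hs
    positivity
  set V := Real.exp (κ * variancePotential (totalCap c n) s) with hV
  have hEA : ∀ j, ∫⁻ ω, A j ω ∂P ≤ ENNReal.ofReal V := by
    intro j
    simp only [hAdef]
    rw [lintegral_lintegral_swap]
    · calc ∫⁻ t, ∫⁻ ω, g j (fun k => θ k ω, t) ∂P ∂uniformAngle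
          ≤ ∫⁻ t, ENNReal.ofReal V ∂uniformAngle := by
            refine lintegral_mono fun t => ?_
            have := lintegral_exp_clusterFluct_le hm hi hu hc hcm hc1 hs hcs hℓ hℓs hκ (hlam j) n
              (z := s - t * Complex.I) (by simp)
            simpa [hgdef, hV] using this
        _ = ENNReal.ofReal V := by simp
    · exact ((hg j).comp ((hθ.comp measurable_fst).prodMk measurable_snd)).aemeasurable
  set thr := Real.exp (ℓ * ε / 3) with hthr
  have hthr0 : 0 < thr := Real.exp_pos _
  have hsub : {ω | ∃ z : ℂ, 2 * s < z.re ∧ ε / 2 ≤ ‖clusterFluct c (fun k => θ k ω) n z‖} ⊆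
      ⋃ j ∈ Finset.range 4, {ω | ENNReal.ofReal (thr / D) ≤ A j ω} := by
    rintro ω ⟨z, hz, hzε⟩
    obtain ⟨j, hj, hjε⟩ := exists_pow_I_re_ge hε hzε
    simp only [Set.mem_iUnion]
    refine ⟨j, hj, ?_⟩
    have h1 := (isLogMap_logClusterMap hc (fun k => θ k ω) n).exp_re_le_lintegral (lam j) hs hz.le
    have h2 : ENNReal.ofReal thr ≤ ENNReal.ofReal D * A j ω := by
      refine le_trans (ENNReal.ofReal_le_ofReal (Real.exp_le_exp.2 ?_)) h1
      have h3 : (lam j * clusterFluct c (fun k => θ k ω) n z).re =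
          ℓ * (Complex.I ^ j * clusterFluct c (fun k => θ k ω) n z).re := by
        rw [hlamdef, mul_assoc, Complex.re_ofReal_mul]
      unfold clusterFluct at h3 hjε
      rw [h3]
      have := mul_le_mul_of_nonneg_left hjε hℓ
      linarith
    show ENNReal.ofReal (thr / D) ≤ A j ω
    rw [ENNReal.ofReal_div_of_pos hD0]
    exact ENNReal.div_le_of_le_mul' h2
  have hj : ∀ j, P {ω | ENNReal.ofReal (thr / D) ≤ A j ω} ≤ ENNReal.ofReal (V / (thr / D)) := by
    intro j
    have h0 : 0 < thr / D := by positivity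
    refine (meas_ge_le_lintegral_div (hA j).aemeasurable (by simpa using h0)
      ENNReal.ofReal_ne_top).trans ?_
    rw [ENNReal.ofReal_div_of_pos h0]
    gcongr
    exact hEA j
  calc P {ω | ∃ z : ℂ, 2 * s < z.re ∧ ε / 2 ≤ ‖clusterFluct c (fun k => θ k ω) n z‖}
      ≤ ∑ j ∈ Finset.range 4, P {ω | ENNReal.ofReal (thr / D) ≤ A j ω} :=
        (measure_mono hsub).trans (measure_biUnion_finset_le _ _)
    _ ≤ ∑ j ∈ Finset.range 4, ENNReal.ofReal (V / (thr / D)) := Finset.sum_le_sum fun j _ => hj j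
    _ = ENNReal.ofReal (4 * (V / (thr / D))) := by
        rw [Finset.sum_const, Finset.card_range, ENNReal.ofReal_mul (by norm_num)]
        simp
    _ ≤ _ := by
        apply ENNReal.ofReal_le_ofReal
        rw [Real.exp_sub, ← hV, ← hthr, hD]
        apply le_of_eq
        field_simp

/-! ### From finitely many capacity levels to all times. -/

lemma norm_clusterFluct_le {c : ℕ → ℝ} (hc : ∀ k, 0 ≤ c k) (θ : ℕ → ℝ) (n : ℕ) {σ : ℝ}
    (hσ : 0 < σ) {z : ℂ} (hz : σ < z.re) :
    ‖clusterFluct c θ n z‖ ≤ 2 * totalCap c n / (Real.exp σ - 1) := by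
  have h1 := (isLogMap_logClusterMap hc θ n).norm_sub_le (hσ.trans hz)
  refine h1.trans ?_
  have h2 := exp_sub_one_pos hσ
  have h3 := totalCap_nonneg hc n
  gcongr

lemma clusterFluct_add (c θ : ℕ → ℝ) (m n : ℕ) (z : ℂ) :
    clusterFluct c θ (m + n) z =
      clusterFluct c θ m (logClusterMap (fun k => c (m + k)) (fun k => θ (m + k)) n z)
        + clusterFluct (fun k => c (m + k)) (fun k => θ (m + k)) n z := by
  simp only [clusterFluct, logClusterMap_add, totalCap_add]
  push_cast
  ring

lemma totalCap_mono {c : ℕ → ℝ} (hc : ∀ k, 0 ≤ c k) : Monotone (totalCap c) :=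
  monotone_nat_of_le_succ fun n => by
    simpa [totalCap, Finset.sum_range_succ] using hc n

lemma totalCap_le {c : ℕ → ℝ} {cmax : ℝ} (hc : ∀ k, c k ≤ cmax) (n : ℕ) :
    totalCap c n ≤ n * cmax := by
  unfold totalCap
  simpa using Finset.sum_le_card_nsmul (Finset.range n) c cmax fun k _ => hc k

/-- The first time at which the total capacity reaches `x`. -/
noncomputable def hitTime (c : ℕ → ℝ) (x : ℝ) : ℕ := sInf {n | x ≤ totalCap c n}

lemma hitTime_le {c : ℕ → ℝ} {x : ℝ} {n : ℕ} (h : x ≤ totalCap c n) : hitTime c x ≤ n :=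
  Nat.sInf_le h

/-- The level must actually be reached: an empty infimum is `0`, and the conclusion could then fail.
-/
lemma le_totalCap_hitTime {c : ℕ → ℝ} {x : ℝ} {n : ℕ} (h : x ≤ totalCap c n) :
    x ≤ totalCap c (hitTime c x) := Nat.sInf_mem (s := {n | x ≤ totalCap c n}) ⟨n, h⟩

/-- Control of the deviation at the hitting times of multiples of `w` controls it at all times. -/
lemma norm_clusterFluct_le_of_hitTime {c : ℕ → ℝ} (hc : ∀ k, 0 ≤ c k) (θ : ℕ → ℝ) {σ w η : ℝ}
    (hσ : 0 < σ) (hw : 0 < w) {N : ℕ}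
    (h : ∀ q ∈ Finset.range (⌊totalCap c N / w⌋₊ + 1), ∀ z : ℂ, σ < z.re →
      ‖clusterFluct c θ (hitTime c (q * w)) z‖ ≤ η)
    {n : ℕ} (hn : n ≤ N) {z : ℂ} (hz : σ < z.re) :
    ‖clusterFluct c θ n z‖ ≤ η + 2 * w / (Real.exp σ - 1) := by
  obtain ⟨q, hq⟩ : ∃ q, q = ⌊totalCap c n / w⌋₊ := ⟨_, rfl⟩
  have hq1 : q * w ≤ totalCap c n := by
    rw [← le_div_iff₀ hw, hq]
    exact Nat.floor_le (div_nonneg (totalCap_nonneg hc n) hw.le)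
  have hq2 : totalCap c n ≤ (q + 1) * w := by
    rw [← div_le_iff₀ hw, hq]
    exact (Nat.lt_floor_add_one _).le
  have hqN : q ∈ Finset.range (⌊totalCap c N / w⌋₊ + 1) := by
    rw [Finset.mem_range, Nat.lt_succ_iff, hq]
    exact Nat.floor_le_floor (div_le_div_of_nonneg_right (totalCap_mono hc hn) hw.le)
  have h1 := h q hqN
  have h2 := hitTime_le hq1
  have h3 := le_totalCap_hitTime hq1
  obtain ⟨m, hmdef⟩ : ∃ m, m = hitTime c (q * w) := ⟨_, rfl⟩
  rw [← hmdef] at h1 h2 h3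
  clear hq hqN
  obtain ⟨k, rfl⟩ := Nat.exists_eq_add_of_le h2
  have hc' : ∀ i, 0 ≤ c (m + i) := fun i => hc _
  rw [clusterFluct_add]
  refine (norm_add_le _ _).trans (add_le_add (h1 _ ?_) ?_)
  -- The later particles move `z` only to the right, so the bound at the hitting time still applies
  -- to the moved point.
  · exact hz.trans_le ((isLogMap_logClusterMap hc' _ k).re_le (hσ.trans hz))
  · refine (norm_clusterFluct_le hc' _ k hσ hz).trans ?_
    have h4 := exp_sub_one_pos hσ
    have h5 : totalCap (fun i => c (m + i)) k ≤ w := by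
      rw [totalCap_add] at hq2
      linarith
    gcongr

lemma iSup_clusterFluct_lt {c θ : ℕ → ℝ} {N : ℕ} {σ η ε : ℝ} (hε : 0 < ε) (hη : η < ε)
    (h : ∀ n ≤ N, ∀ z : ℂ, σ < z.re → ‖clusterFluct c θ n z‖ ≤ η) :
    (⨆ n ≤ N, ⨆ z ∈ {z : ℂ | σ < z.re}, ‖logClusterMap c θ n z - z - totalCap c n‖ₑ)
      < ENNReal.ofReal ε := by
  refine lt_of_le_of_lt ?_ ((ENNReal.ofReal_lt_ofReal_iff hε).2 hη)
  refine iSup₂_le fun n hn => iSup₂_le fun z hz => ?_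
  rw [← ofReal_norm]
  exact ENNReal.ofReal_le_ofReal (h n hn z hz)

/-- Probability that the deviation stays small for all times up to `N`. -/
lemma le_measureReal_iSup_lt {Ω : Type*} [MeasurableSpace Ω] {P : Measure Ω}
    [IsProbabilityMeasure P] {θ : ℕ → Ω → ℝ} (hm : ∀ k, Measurable (θ k)) (hi : iIndepFun θ P)
    (hu : ∀ k, pdf.IsUniform (θ k) (Set.Ico 0 (2 * Real.pi)) P)
    {c : ℕ → ℝ} {cmax σ κ ℓ ε : ℝ} (hc : ∀ k, 0 ≤ c k) (hcm : ∀ k, c k ≤ cmax) (hc1 : cmax ≤ 1)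
    (hσ : 0 < σ) (hcs : cmax ≤ σ ^ 3) (hℓ : 0 ≤ ℓ)
    (hℓs : ℓ * cmax * (16 * jumpConst) ≤ σ / 2) (hκ : κ = ℓ ^ 2 * cmax * (16 * jumpConst))
    (hε : 0 < ε) (N : ℕ) :
    1 - (8 * totalCap c N / (ε * (Real.exp σ - 1)) + 1) * (4 / (1 - Real.exp (-(σ / 2))) *
        Real.exp (κ * variancePotential (totalCap c N) (σ / 2) - ℓ * ε / 3)) ≤
      P.real {ω | (⨆ n ≤ N, ⨆ z ∈ {z : ℂ | σ < z.re},
        ‖logClusterMap c (fun k => θ k ω) n z - z - totalCap c n‖ₑ) < ENNReal.ofReal ε} := by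
  set E := {ω | (⨆ n ≤ N, ⨆ z ∈ {z : ℂ | σ < z.re},
        ‖logClusterMap c (fun k => θ k ω) n z - z - totalCap c n‖ₑ) < ENNReal.ofReal ε} with hE
  have hs : 0 < σ / 2 := by positivity
  have he := exp_sub_one_pos hσ
  have hT := totalCap_nonneg hc N
  have hcmax : 0 ≤ cmax := (hc 0).trans (hcm 0)
  have hJ : 0 ≤ jumpConst := by unfold jumpConst; positivity
  have hκ0 : 0 ≤ κ := by rw [hκ]; positivity
  -- With this mesh the error between levels is `ε/4`; with `ε/2` at the levels the total stays
  -- strictly below `ε`.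
  set w := ε * (Real.exp σ - 1) / 8 with hw
  have hw0 : 0 < w := by positivity
  set Q := ⌊totalCap c N / w⌋₊ with hQ
  set bad : ℕ → Set Ω := fun q => {ω | ∃ z : ℂ, 2 * (σ / 2) < z.re ∧
    ε / 2 ≤ ‖clusterFluct c (fun k => θ k ω) (hitTime c (q * w)) z‖} with hbad
  set M := 4 / (1 - Real.exp (-(σ / 2))) *
        Real.exp (κ * variancePotential (totalCap c N) (σ / 2) - ℓ * ε / 3) with hM
  have hM0 : 0 ≤ M := by
    have := one_sub_exp_neg_pos hs
    positivity
  have hsub : Eᶜ ⊆ ⋃ q ∈ Finset.range (Q + 1), bad q := by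
    intro ω hω
    by_contra hn
    simp only [Set.mem_iUnion, not_exists] at hn
    apply hω
    refine iSup_clusterFluct_lt hε (η := ε / 2 + 2 * w / (Real.exp σ - 1)) ?_ fun n hnN z hz => ?_
    · have : 2 * w / (Real.exp σ - 1) = ε / 4 := by
        rw [hw]
        field_simp
        norm_num
      rw [this]
      linarith
    · refine norm_clusterFluct_le_of_hitTime hc _ hσ hw0 (fun q hq z hz => ?_) hnN hz
      by_contra hlt
      exact hn q hq ⟨z, by linarith, (not_le.1 hlt).le⟩
  have hb : ∀ q ∈ Finset.range (Q + 1), P.real (bad q) ≤ M := by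
    intro q hq
    have hqQ : q ≤ Q := Nat.lt_succ_iff.1 (Finset.mem_range.1 hq)
    have hqw : q * w ≤ totalCap c N := by
      rw [← le_div_iff₀ hw0]
      exact (Nat.cast_le.2 hqQ).trans (Nat.floor_le (by positivity))
    have h1 := measure_clusterFluct_ge_le hm hi hu hc hcm hc1 hs
      (by rwa [mul_div_cancel₀ _ two_ne_zero]) hℓ hℓs hκ hε (hitTime c (q * w))
    refine ENNReal.toReal_le_of_le_ofReal hM0 (h1.trans (ENNReal.ofReal_le_ofReal ?_))
    have h2 := variancePotential_mono hs (totalCap_nonneg hc _)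
      (totalCap_mono hc (hitTime_le hqw))
    have := one_sub_exp_neg_pos hs
    rw [hM]
    gcongr
  have hcompl : P.real Eᶜ ≤ (Q + 1) * M := by
    calc P.real Eᶜ ≤ P.real (⋃ q ∈ Finset.range (Q + 1), bad q) :=
          measureReal_mono hsub (measure_ne_top _ _)
      _ ≤ ∑ q ∈ Finset.range (Q + 1), P.real (bad q) := measureReal_biUnion_finset_le _ _
      _ ≤ ∑ q ∈ Finset.range (Q + 1), M := Finset.sum_le_sum hb
      _ = (Q + 1) * M := by simp
  -- Subadditivity suffices, so measurability of the supremum event is not needed.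
  have hone : 1 ≤ P.real E + P.real Eᶜ := by
    have h1 := measureReal_union_le (μ := P) E Eᶜ
    rwa [Set.union_compl_self, probReal_univ] at h1
  have hQle : (Q : ℝ) ≤ 8 * totalCap c N / (ε * (Real.exp σ - 1)) := by
    refine (Nat.floor_le (by positivity)).trans (le_of_eq ?_)
    rw [hw]
    field_simp
  have : ((Q : ℝ) + 1) * M ≤ (8 * totalCap c N / (ε * (Real.exp σ - 1)) + 1) * M := by gcongr
  linarith

/-! ### Comparison with the stated error bound. -/

/-- The denominator of the rate, up to constants. -/
noncomputable def rateDenom (σ ε : ℝ) (N : ℕ) : ℝ := Real.log ((σ + N * ε) / σ) + ε / σ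

lemma div_le_rateDenom {σ ε : ℝ} (hσ : 0 < σ) (hε : 0 < ε) (N : ℕ) : ε / σ ≤ rateDenom σ ε N := by
  have : 0 ≤ Real.log ((σ + N * ε) / σ) := by
    apply Real.log_nonneg
    rw [le_div_iff₀ hσ]
    have : (0 : ℝ) ≤ N * ε := by positivity
    linarith
  unfold rateDenom
  linarith

lemma rateDenom_pos {σ ε : ℝ} (hσ : 0 < σ) (hε : 0 < ε) (N : ℕ) : 0 < rateDenom σ ε N :=
  lt_of_lt_of_le (by positivity) (div_le_rateDenom hσ hε N)

lemma rateDenom_le {σ ε : ℝ} (hσ : 0 < σ) (hε : 0 < ε) (N : ℕ) (hσε : 0 < σ - 3 * ε) :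
    rateDenom σ ε N ≤
      Real.log (1 / (σ - 3 * ε)) + Real.log (σ + N * ε) + ε / (σ - ε) := by
  have h0 : (0 : ℝ) < σ + N * ε := by positivity
  unfold rateDenom
  rw [Real.log_div h0.ne' hσ.ne', one_div, Real.log_inv]
  have h1 : Real.log (σ - 3 * ε) ≤ Real.log σ := Real.log_le_log hσε (by linarith)
  have h2 : ε / σ ≤ ε / (σ - ε) := div_le_div_of_nonneg_left hε.le (by linarith) (by linarith)
  linarith

/-- Separates `Nc/ε`, which bounds the number of capacity levels, from a power of `c/ε²`, the
inverse scale of the exponent. -/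
lemma prefactor_eq {c ε m : ℝ} (hc : 0 < c) (hε : 0 < ε) (N : ℕ) :
    N * (c ^ (8 / 5 : ℝ) / (ε ^ (11 / 5 : ℝ) * m)) =
      N * c / ε * ((c / ε ^ 2) ^ (3 / 5 : ℝ) / m) := by
  have h1 : c ^ (8 / 5 : ℝ) = c * c ^ (3 / 5 : ℝ) := by
    rw [← Real.rpow_one_add' hc.le (by norm_num)]
    norm_num
  have h2 : ε ^ (11 / 5 : ℝ) = ε * (ε ^ 2) ^ (3 / 5 : ℝ) := by
    rw [← Real.rpow_natCast, ← Real.rpow_mul hε.le, ← Real.rpow_one_add' hε.le (by norm_num)]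
    norm_num
  rw [h1, h2, Real.div_rpow hc.le (by positivity)]
  have : (ε ^ 2) ^ (3 / 5 : ℝ) ≠ 0 := by positivity
  field_simp

lemma min_rpow_le {σ σ' : ℝ} (hσ' : 0 < σ') (h : σ' ≤ σ) :
    min (σ' ^ (9 / 5 : ℝ)) 1 ≤ (min σ 1) ^ (9 / 5 : ℝ) := by
  rcases le_total σ 1 with h1 | h1
  · rw [min_eq_left h1]
    exact (min_le_left _ _).trans (Real.rpow_le_rpow hσ'.le h (by norm_num))
  · rw [min_eq_right h1, Real.one_rpow]
    exact min_le_right _ _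

lemma self_mul_exp_half_le {σ : ℝ} (hσ : 0 ≤ σ) : σ * Real.exp (σ / 2) ≤ Real.exp σ - 1 := by
  have h1 := Real.self_le_sinh_iff.2 (show 0 ≤ σ / 2 by positivity)
  rw [Real.sinh_eq] at h1
  have h2 : Real.exp σ = Real.exp (σ / 2) * Real.exp (σ / 2) := by rw [← Real.exp_add]; ring_nf
  have h3 : Real.exp (-(σ / 2)) * Real.exp (σ / 2) = 1 := by rw [← Real.exp_add]; simp
  nlinarith [Real.exp_pos (σ / 2)]

/-- If the exponent is at most of order `σ`, the error bound is at least one. -/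
lemma one_le_of_exponent_le {σ X ρ A a K : ℝ} (hσ : 0 < σ) (hX : (Real.exp σ - 1) / 4 ≤ X)
    (hρ : 1 / σ ^ (9 / 5 : ℝ) ≤ ρ) (hA : 16 ≤ A) (ha : a ≤ 1 / 4) (hK0 : 0 ≤ K) (hK : K ≤ σ) :
    1 ≤ A * (X * ρ) * Real.exp (-(a * K)) := by
  have h1 := self_mul_exp_half_le hσ.le
  have h2 : Real.exp (-(σ / 4)) ≤ Real.exp (-(a * K)) := Real.exp_le_exp.2 (by nlinarith)
  have h3 : σ ^ (9 / 5 : ℝ) ≤ σ * (1 + σ) := by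
    have e1 : σ ^ (9 / 5 : ℝ) = σ * σ ^ (4 / 5 : ℝ) := by
      rw [← Real.rpow_one_add' hσ.le (by norm_num)]
      norm_num
    rw [e1]
    gcongr
    rcases le_total σ 1 with h | h
    · linarith [Real.rpow_le_one hσ.le h (show (0 : ℝ) ≤ 4 / 5 by norm_num)]
    · have := Real.rpow_le_rpow_of_exponent_le h (show (4 / 5 : ℝ) ≤ 1 by norm_num)
      rw [Real.rpow_one] at this
      linarith
  have h4 := Real.add_one_le_exp (σ / 4)
  have h5 : Real.exp (σ / 2) * Real.exp (-(σ / 4)) = Real.exp (σ / 4) := by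
    rw [← Real.exp_add]; ring_nf
  have hp : 0 < σ ^ (9 / 5 : ℝ) := by positivity
  have hX0 : 0 ≤ X := le_trans (by linarith [exp_sub_one_pos hσ]) hX
  have hρ0 : 0 ≤ ρ := le_trans (by positivity) hρ
  have hA0 : 0 ≤ A := by linarith
  -- `X` is at least `σ e^{σ/2}/4`, the exponential costs at most `e^{-σ/4}`, and what remains beats
  -- `σ^{9/5} ≤ σ(1 + σ)`.
  calc (1 : ℝ) ≤ 4 * (σ * Real.exp (σ / 4)) / σ ^ (9 / 5 : ℝ) := by
        rw [le_div_iff₀ hp]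
        nlinarith
    _ = 16 * (σ * Real.exp (σ / 2) / 4 * (1 / σ ^ (9 / 5 : ℝ))) * Real.exp (-(σ / 4)) := by
        rw [← h5]
        ring
    _ ≤ A * (X * ρ) * Real.exp (-(a * K)) := by
        gcongr
        linarith

/-- The regime of large capacity or small deviation, in which the error bound is at least one. -/
lemma one_le_of_large_cap {c ε σ σ' A a : ℝ} {N : ℕ} (hc : 0 < c) (hε : 0 < ε) (hσ : 0 < σ)
    (hσ' : 0 < σ') (hσσ : σ' ≤ σ) (hεσ : ε < σ / 3) (hcσ : c ≤ σ ^ 3)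
    (hX : (Real.exp σ - 1) / 4 ≤ N * c / ε) (hA : 16 ≤ A) (ha : a ≤ 1 / 4)
    (h : ε < c ∨ 1 < c) :
    1 ≤ A * (N * c / ε * ((c / ε ^ 2) ^ (3 / 5 : ℝ) / min (σ' ^ (9 / 5 : ℝ)) 1)) *
      Real.exp (-(a * (ε ^ 2 / (c * rateDenom σ ε N)))) := by
  have hL := rateDenom_pos hσ hε N
  have hL1 := div_le_rateDenom hσ hε N
  have hm0 : 0 < min (σ' ^ (9 / 5 : ℝ)) 1 := lt_min (by positivity) one_pos
  refine one_le_of_exponent_le hσ hX ?_ hA ha (by positivity) ?_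
  · rcases le_or_gt c 1 with hc1 | hc1
    · have hεc : ε < c := by
        rcases h with h | h
        · exact h
        · linarith
      have h1 : 1 ≤ (c / ε ^ 2) ^ (3 / 5 : ℝ) := by
        apply Real.one_le_rpow _ (by norm_num)
        rw [le_div_iff₀ (by positivity)]
        nlinarith
      have h2 : min (σ' ^ (9 / 5 : ℝ)) 1 ≤ σ ^ (9 / 5 : ℝ) :=
        (min_le_left _ _).trans (Real.rpow_le_rpow hσ'.le hσσ (by norm_num))
      gcongr
    · have hσ1 : 1 < σ := by
        by_contra hn
        have := pow_le_one₀ (n := 3) hσ.le (not_lt.1 hn)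
        linarith
      -- Its `3/5`-th power is `σ^{-9/5}`, the size required of the polynomial factor.
      have h1 : 1 / σ ^ 3 ≤ c / ε ^ 2 := by
        rw [div_le_div_iff₀ (by positivity) (by positivity)]
        rcases le_or_gt c ε with h2 | h2
        · have : ε ^ 2 ≤ σ ^ 2 := by gcongr; linarith
          have : σ ^ 2 ≤ σ ^ 3 := pow_le_pow_right₀ hσ1.le (by norm_num)
          have : σ ^ 3 ≤ c * σ ^ 3 := le_mul_of_one_le_left (by positivity) hc1.le
          linarith
        · have : ε ^ 2 ≤ c ^ 2 := by gcongr
          nlinarith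
      have h2 : (1 / σ ^ 3) ^ (3 / 5 : ℝ) = 1 / σ ^ (9 / 5 : ℝ) := by
        rw [Real.div_rpow zero_le_one (by positivity), Real.one_rpow, ← Real.rpow_natCast,
          ← Real.rpow_mul hσ.le]
        norm_num
      have h3 := Real.rpow_le_rpow (by positivity) h1 (show (0 : ℝ) ≤ 3 / 5 by norm_num)
      rw [h2] at h3
      exact h3.trans (le_div_self (by positivity) hm0 (min_le_right _ _))
  · rw [div_le_iff₀ (by positivity)]
    rcases lt_or_ge ε c with hεc | hεc
    · have h1 : ε ≤ rateDenom σ ε N * σ := by rwa [div_le_iff₀ hσ] at hL1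
      nlinarith
    · have hc1 : 1 < c := by
        rcases h with h | h
        · linarith
        · exact h
      -- Since `Nc/ε` is at least of order `e^σ - 1` while `c ≤ ε < σ/3`, the quantity `Nε` is
      -- exponentially large in `σ`, and the logarithm in the rate is of order `σ`.
      have h1 : σ / 4 ≤ rateDenom σ ε N := by
        have h2 : Real.exp (σ / 4) ≤ (σ + N * ε) / σ := by
          have e1 := self_mul_exp_half_le hσ.le
          have e2 : Real.exp (σ / 2) = Real.exp (σ / 4) ^ 2 := by
            rw [← Real.exp_nat_mul]; ring_nf
          have e3 : σ * Real.exp (σ / 4) ^ 2 / 4 ≤ N * ε := by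
            rw [le_div_iff₀ hε] at hX
            rw [e2] at e1
            have e4 : σ * Real.exp (σ / 4) ^ 2 / 4 * ε ≤ N * c :=
              le_trans (by gcongr) hX
            have e5 : (0 : ℝ) ≤ N := by positivity
            have e6 : N * c ≤ N * ε * ε := by
              rw [mul_assoc]
              gcongr
              nlinarith
            exact le_of_mul_le_mul_right (e4.trans e6) hε
          rw [le_div_iff₀ hσ]
          nlinarith [sq_nonneg (Real.exp (σ / 4) / 2 - 1)]
        have h3 := (Real.le_log_iff_exp_le (by positivity)).2 h2
        have : 0 < ε / σ := by positivity
        unfold rateDenom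
        linarith
      have h2 : ε ^ 2 ≤ σ * (σ / 4) := by nlinarith
      have h3 : σ * (σ / 4) ≤ σ * (c * rateDenom σ ε N) := by
        gcongr
        nlinarith
      linarith

/-- The constant in the exponential rate. -/
noncomputable def rateConst : ℝ := 1 / (36 * (16 * jumpConst))

lemma one_le_jumpConst : 1 ≤ jumpConst := by
  unfold jumpConst
  linarith [Real.add_one_le_exp 10]

lemma rateConst_pos : 0 < rateConst := by
  have := one_le_jumpConst
  unfold rateConst
  positivity

lemma rateConst_le : rateConst ≤ 1 := by
  have := one_le_jumpConst
  unfold rateConst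
  rw [div_le_one (by positivity)]
  linarith

lemma div_four_le_one_sub_exp {σ : ℝ} (hσ : 0 < σ) :
    min σ 1 / 4 ≤ 1 - Real.exp (-(σ / 2)) := by
  have hv0 : 0 < min σ 1 := lt_min hσ one_pos
  have hv1 : min σ 1 ≤ 1 := min_le_right _ _
  have h1 : Real.exp (-(σ / 2)) ≤ Real.exp (-(min σ 1 / 2)) :=
    Real.exp_le_exp.2 (by linarith [min_le_left σ 1])
  have h2 := Real.add_one_le_exp (min σ 1 / 2)
  have h3 : Real.exp (-(min σ 1 / 2)) * Real.exp (min σ 1 / 2) = 1 := by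
    rw [← Real.exp_add]; simp
  have h4 := Real.exp_pos (-(min σ 1 / 2))
  nlinarith

/-- The potential grows only logarithmically as `σ → 0`; it is bounded by a square root because this
power balances the final interpolation. -/
lemma effective_denom_le {T σ ε : ℝ} (hσ : 0 < σ) (hT : 0 ≤ T) (hεσ : ε < σ / 3) :
    variancePotential T (σ / 2) + ε / (σ / 2) ≤ 4 / √(min σ 1) := by
  have hv0 : 0 < min σ 1 := lt_min hσ one_pos
  have hr0 : 0 < √(min σ 1) := Real.sqrt_pos.2 hv0
  have h1 := variancePotential_le_neg_log (show 0 < σ / 2 by positivity) hT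
  have h2 := Real.log_le_log (by positivity) (div_four_le_one_sub_exp hσ)
  have h3 : ε / (σ / 2) ≤ 2 / 3 := by
    rw [div_le_iff₀ (by positivity)]
    linarith
  have h4 : -Real.log (min σ 1 / 4) = 2 * Real.log (2 / √(min σ 1)) := by
    rw [← Real.log_inv, inv_div, two_mul, ← Real.log_mul (by positivity) (by positivity)]
    congr 1
    rw [div_mul_div_comm, Real.mul_self_sqrt hv0.le]
    norm_num
  have h5 := Real.log_le_sub_one_of_pos (show 0 < 2 / √(min σ 1) by positivity)
  have h6 : 4 / √(min σ 1) = 2 * (2 / √(min σ 1)) := by ring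
  linarith

/-- Working at `σ/2` instead of `σ` costs a factor 2, by `1 + 2y ≤ (1 + y)²`. The assumption `c ≤ ε`
turns `T ≤ Nc` into `T ≤ Nε`. -/
lemma effective_denom_le_rateDenom {T c σ ε : ℝ} {N : ℕ} (hσ : 0 < σ) (hT : 0 ≤ T)
    (hTN : T ≤ N * c) (hcε : c ≤ ε) :
    variancePotential T (σ / 2) + ε / (σ / 2) ≤ 2 * rateDenom σ ε N := by
  have h1 := variancePotential_le_div (show 0 < σ / 2 by positivity) hT
  have hN : (0 : ℝ) ≤ N := by positivity
  have hTε : T ≤ N * ε := hTN.trans (by gcongr)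
  have h2 : Real.log ((σ / 2 + T) / (σ / 2)) ≤ 2 * Real.log ((σ + N * ε) / σ) := by
    rw [← Nat.cast_ofNat (R := ℝ), ← Real.log_pow]
    apply Real.log_le_log (by positivity)
    have e1 : (σ / 2 + T) / (σ / 2) = 1 + 2 * (T / σ) := by field_simp
    have e2 : (σ + N * ε) / σ = 1 + N * ε / σ := by field_simp
    rw [Nat.cast_ofNat, e1, e2]
    have e3 : T / σ ≤ N * ε / σ := by gcongr
    have e4 : 0 ≤ T / σ := by positivity
    nlinarith
  have h3 : ε / (σ / 2) = 2 * (ε / σ) := by field_simp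
  unfold rateDenom
  linarith

/-- Comparison of the probability bound with the one claimed, in the main regime. -/
lemma prob_le_of_small_cap {c ε σ σ' T D p : ℝ} {N : ℕ} (hc : 0 < c) (hε : 0 < ε) (hσ : 0 < σ)
    (hσ' : 0 < σ') (hσσ : σ' ≤ σ) (hTN : T ≤ N * c) (hD : 0 < D)
    (hDσ : D ≤ 4 / √(min σ 1)) (hDr : D ≤ 2 * rateDenom σ ε N)
    (hX : (Real.exp σ - 1) / 4 ≤ N * c / ε) (hp0 : 0 ≤ p) (hp1 : p ≤ 1)
    (hp : p ≤ (8 * T / (ε * (Real.exp σ - 1)) + 1) * (4 / (1 - Real.exp (-(σ / 2))) *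
        Real.exp (-(rateConst * (ε ^ 2 / (c * D)))))) :
    p ≤ 28 * (1 + 16 / rateConst) *
      (N * c / ε * ((c / ε ^ 2) ^ (3 / 5 : ℝ) / min (σ' ^ (9 / 5 : ℝ)) 1)) *
      Real.exp (-(rateConst / 8 * (ε ^ 2 / (c * rateDenom σ ε N)))) := by
  have ha := rateConst_pos
  have he := exp_sub_one_pos hσ
  have hL := rateDenom_pos hσ hε N
  obtain ⟨a, ha_def⟩ : ∃ a, a = rateConst := ⟨_, rfl⟩
  rw [← ha_def] at ha hp ⊢
  obtain ⟨v, hv⟩ : ∃ v, v = min σ 1 := ⟨_, rfl⟩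
  have hv0 : 0 < v := by rw [hv]; exact lt_min hσ one_pos
  have hvσ : v ≤ Real.exp σ - 1 := by
    have := Real.add_one_le_exp σ
    linarith [min_le_left σ 1]
  obtain ⟨X, hXdef⟩ : ∃ X, X = N * c / ε := ⟨_, rfl⟩
  obtain ⟨Y, hY⟩ : ∃ Y, Y = X / (Real.exp σ - 1) := ⟨_, rfl⟩
  obtain ⟨K, hK⟩ : ∃ K, K = ε ^ 2 / (c * D) := ⟨_, rfl⟩
  have hK0 : 0 < K := by rw [hK]; positivity
  rw [← hXdef] at hX ⊢
  have hY4 : 1 / 4 ≤ Y := by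
    rw [hY, le_div_iff₀ he]
    linarith
  have hX0 : 0 < X := by linarith
  have hYv : Y ≤ X / v := by rw [hY]; gcongr
  -- the basic bound in terms of `Y`, `v`, `K`
  have hp2 : p ≤ 192 * Y / v * Real.exp (-(a * K)) := by
    refine hp.trans ?_
    have h1 : 8 * T / (ε * (Real.exp σ - 1)) + 1 ≤ 12 * Y := by
      have : 8 * T / (ε * (Real.exp σ - 1)) ≤ 8 * Y := by
        rw [hY, hXdef, div_div, ← mul_div_assoc]
        gcongr
      linarith
    have h2 : 4 / (1 - Real.exp (-(σ / 2))) ≤ 16 / v := by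
      have h3 := div_four_le_one_sub_exp hσ
      rw [← hv] at h3
      rw [div_le_div_iff₀ (by linarith) hv0]
      linarith
    have h4 := one_sub_exp_neg_pos (show 0 < σ / 2 by positivity)
    rw [← hK, ← mul_assoc]
    calc _ ≤ 12 * Y * (16 / v) * Real.exp (-(a * K)) := by gcongr
      _ = _ := by ring
  -- With `q` the tenth root of `v`, the powers `v^{1/2}`, `v^{3/10}` and `v^{9/5}` become `q^5`,
  -- `q^3` and `q^18`. The final balance is `q^3 / q^18 = 1 / (q^10 q^5)`.
  obtain ⟨q, hq⟩ : ∃ q, q = v ^ (1 / 10 : ℝ) := ⟨_, rfl⟩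
  have hq0 : 0 < q := by rw [hq]; positivity
  have hqv : v = q ^ 10 := by
    rw [hq, ← Real.rpow_natCast, ← Real.rpow_mul hv0.le]
    norm_num
  -- interpolation between the trivial bound and the basic bound
  have hp3 : p ≤ 28 * (X / v) / q ^ 5 * Real.exp (-(a * K / 2)) := by
    have h1 : p ≤ 28 * Y / q ^ 5 * Real.exp (-(a * K / 2)) := by
      apply le_of_sq_le_sq _ (by positivity)
      have e1 : Real.exp (-(a * K / 2)) ^ 2 = Real.exp (-(a * K)) := by
        rw [← Real.exp_nat_mul]
        congr 1
        push_cast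
        ring
      calc p ^ 2 ≤ p := pow_le_of_le_one hp0 hp1 two_ne_zero
        _ ≤ 192 * Y / v * Real.exp (-(a * K)) := hp2
        _ ≤ 784 * Y ^ 2 / v * Real.exp (-(a * K)) := by
            gcongr ?_ / v * _
            nlinarith only [hY4]
        _ = (28 * Y / q ^ 5 * Real.exp (-(a * K / 2))) ^ 2 := by
            rw [mul_pow, e1, div_pow, hqv]
            ring
    refine h1.trans ?_
    gcongr
  have hs : √v = q ^ 5 := by
    rw [hqv, show q ^ 10 = (q ^ 5) ^ 2 by ring, Real.sqrt_sq (by positivity)]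
  rw [← hv, hs] at hDσ
  -- the polynomial factor
  have hr : q ^ 3 / (4 * K) ^ (3 / 5 : ℝ) ≤ (c / ε ^ 2) ^ (3 / 5 : ℝ) := by
    have h1 : q ^ 5 / (4 * K) ≤ c / ε ^ 2 := by
      have h2 : c / ε ^ 2 = 1 / (D * K) := by
        rw [hK]
        field_simp
      rw [h2, div_le_div_iff₀ (by positivity) (by positivity)]
      rw [le_div_iff₀ (by positivity)] at hDσ
      have h3 := mul_le_mul_of_nonneg_right hDσ hK0.le
      linarith
    have h2 := Real.rpow_le_rpow (by positivity) h1 (show (0 : ℝ) ≤ 3 / 5 by norm_num)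
    rw [Real.div_rpow (by positivity) (by positivity)] at h2
    have h3 : (q ^ 5) ^ (3 / 5 : ℝ) = q ^ 3 := by
      rw [← Real.rpow_natCast, ← Real.rpow_mul hq0.le, ← Real.rpow_natCast q 3]
      norm_num
    rwa [h3] at h2
  have hm : min (σ' ^ (9 / 5 : ℝ)) 1 ≤ q ^ 18 := by
    refine (min_rpow_le hσ' hσσ).trans (le_of_eq ?_)
    rw [← hv, hqv, ← Real.rpow_natCast, ← Real.rpow_mul hq0.le, ← Real.rpow_natCast q 18]
    norm_num
  have hm0 : 0 < min (σ' ^ (9 / 5 : ℝ)) 1 := lt_min (by positivity) one_pos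
  -- Half of the remaining exponential absorbs this power of `K`; the other half becomes the stated
  -- rate.
  have hpoly : (4 * K) ^ (3 / 5 : ℝ) ≤ (1 + 16 / a) * Real.exp (a * K / 4) := by
    have h1 : (4 * K) ^ (3 / 5 : ℝ) ≤ 1 + 4 * K := by
      rcases le_total (4 * K) 1 with h | h
      · linarith [Real.rpow_le_one (by positivity) h (show (0 : ℝ) ≤ 3 / 5 by norm_num)]
      · have := Real.rpow_le_rpow_of_exponent_le h (show (3 / 5 : ℝ) ≤ 1 by norm_num)
        rw [Real.rpow_one] at this
        linarith
    have h2 := Real.add_one_le_exp (a * K / 4)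
    have h3 : 4 * K = 16 / a * (a * K / 4) := by field_simp; norm_num
    have h4 : 0 < a * K / 4 := by positivity
    have h5 : 16 / a * (a * K / 4) ≤ 16 / a * Real.exp (a * K / 4) := by
      gcongr
      linarith
    rw [← h3] at h5
    linarith
  have hexp : Real.exp (-(a * K / 4)) ≤
      Real.exp (-(a / 8 * (ε ^ 2 / (c * rateDenom σ ε N)))) := by
    apply Real.exp_le_exp.2
    have h1 : ε ^ 2 / (c * rateDenom σ ε N) ≤ 2 * K := by
      rw [hK, ← mul_div_assoc, div_le_div_iff₀ (by positivity) (by positivity)]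
      have h2 := mul_le_mul_of_nonneg_left hDr (show 0 ≤ ε ^ 2 * c by positivity)
      linarith
    have h2 := mul_le_mul_of_nonneg_left h1 (show 0 ≤ a / 8 by positivity)
    linarith
  refine hp3.trans ?_
  have hexp2 : Real.exp (-(a * K / 2)) = Real.exp (-(a * K / 4)) * Real.exp (-(a * K / 4)) := by
    rw [← Real.exp_add]
    ring_nf
  have hexp3 : Real.exp (a * K / 4) * Real.exp (-(a * K / 4)) = 1 := by
    rw [← Real.exp_add]
    simp
  have hKp : 0 < (4 * K) ^ (3 / 5 : ℝ) := by positivity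
  have hfac : Real.exp (-(a * K / 4)) ≤ (1 + 16 / a) * (1 / (4 * K) ^ (3 / 5 : ℝ)) := by
    rw [mul_one_div, le_div_iff₀ hKp]
    calc Real.exp (-(a * K / 4)) * (4 * K) ^ (3 / 5 : ℝ)
        ≤ Real.exp (-(a * K / 4)) * ((1 + 16 / a) * Real.exp (a * K / 4)) := by gcongr
      _ = 1 + 16 / a := by linear_combination (1 + 16 / a) * hexp3
  calc 28 * (X / v) / q ^ 5 * Real.exp (-(a * K / 2))
      = 28 * (X / v) / q ^ 5 * Real.exp (-(a * K / 4)) * Real.exp (-(a * K / 4)) := by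
        rw [hexp2, mul_assoc]
    _ ≤ 28 * (X / v) / q ^ 5 * ((1 + 16 / a) * (1 / (4 * K) ^ (3 / 5 : ℝ))) *
          Real.exp (-(a / 8 * (ε ^ 2 / (c * rateDenom σ ε N)))) := by gcongr
    _ = 28 * (1 + 16 / a) * (X * (q ^ 3 / (4 * K) ^ (3 / 5 : ℝ) / q ^ 18)) *
          Real.exp (-(a / 8 * (ε ^ 2 / (c * rateDenom σ ε N)))) := by
        rw [hqv]
        field_simp
    _ ≤ _ := by gcongr

end HastingsLevitov

/-! ### Choice of the tilt and conclusion. -/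

theorem theorem5p1 : ∃ A A' : ℝ, 0 < A ∧ 0 < A' ∧
    ∀ (Ω : Type*) [MeasurableSpace Ω] (P : Measure Ω) [IsProbabilityMeasure P]
      (θ : ℕ → Ω → ℝ), (∀ k, Measurable (θ k)) → iIndepFun θ P →
      (∀ k, pdf.IsUniform (θ k) (Set.Ico 0 (2 * Real.pi)) P) →
    ∀ (cmax : ℝ) (c : ℕ → ℝ), (∀ k, 0 < c k ∧ c k ≤ cmax) →
    ∀ (N : ℕ) (σ ε : ℝ), 0 < σ → 0 < ε → ε < σ / 3 →
      max (HastingsLevitov.slitLength cmax) (cmax ^ (1 / 3 : ℝ)) < σ - 3 * ε →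
      1 - A * N * (cmax ^ (8 / 5 : ℝ) /
            (ε ^ (11 / 5 : ℝ) * min ((σ - 3 * ε) ^ (9 / 5 : ℝ)) 1)) *
          Real.exp (-(A' / (Real.log (1 / (σ - 3 * ε)) + Real.log (σ + N * ε) + ε / (σ - ε)) *
            (ε ^ 2 / cmax)))
        ≤ P.real {ω | (⨆ n ≤ N, ⨆ z ∈ {z : ℂ | σ < z.re},
            ‖HastingsLevitov.logClusterMap c (fun k => θ k ω) n z - z
              - HastingsLevitov.totalCap c n‖ₑ) < ENNReal.ofReal ε} := by
  open HastingsLevitov in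
  have ha := rateConst_pos
  have ha1 := rateConst_le
  refine ⟨28 * (1 + 16 / rateConst), rateConst / 8, by positivity, by positivity, ?_⟩
  intro Ω _ P _ θ hm hi hu cmax c hcb N σ ε hσ hε hεσ hmax
  have hc : ∀ k, 0 ≤ c k := fun k => (hcb k).1.le
  have hcm : ∀ k, c k ≤ cmax := fun k => (hcb k).2
  have hc0 : 0 < cmax := (hcb 0).1.trans_le (hcb 0).2
  have hσ' : 0 < σ - 3 * ε := by linarith
  have he := exp_sub_one_pos hσ
  have hcσ : cmax ≤ σ ^ 3 := by
    have h1 : cmax ^ (1 / 3 : ℝ) ≤ σ := by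
      linarith [le_max_right (slitLength cmax) (cmax ^ (1 / 3 : ℝ))]
    have h2 : (cmax ^ (1 / 3 : ℝ)) ^ 3 = cmax := by
      rw [← Real.rpow_natCast, ← Real.rpow_mul hc0.le]
      norm_num
    rw [← h2]
    gcongr
  set E := {ω | (⨆ n ≤ N, ⨆ z ∈ {z : ℂ | σ < z.re},
            ‖HastingsLevitov.logClusterMap c (fun k => θ k ω) n z - z
              - HastingsLevitov.totalCap c n‖ₑ) < ENNReal.ofReal ε} with hE
  have hL := rateDenom_pos hσ hε N
  have hLle := rateDenom_le hσ hε N hσ'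
  have hm0 : 0 < min ((σ - 3 * ε) ^ (9 / 5 : ℝ)) 1 := lt_min (by positivity) one_pos
  set A := 28 * (1 + 16 / rateConst) with hA
  have hA0 : 0 < A := by positivity
  set B := A * (N * cmax / ε * ((cmax / ε ^ 2) ^ (3 / 5 : ℝ) /
    min ((σ - 3 * ε) ^ (9 / 5 : ℝ)) 1)) *
      Real.exp (-(rateConst / 8 * (ε ^ 2 / (cmax * rateDenom σ ε N)))) with hB
  have hBle : B ≤ A * N * (cmax ^ (8 / 5 : ℝ) /
            (ε ^ (11 / 5 : ℝ) * min ((σ - 3 * ε) ^ (9 / 5 : ℝ)) 1)) *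
          Real.exp (-(rateConst / 8 /
            (Real.log (1 / (σ - 3 * ε)) + Real.log (σ + N * ε) + ε / (σ - ε)) *
            (ε ^ 2 / cmax))) := by
    have h1 : rateConst / 8 * (ε ^ 2 / (cmax * rateDenom σ ε N)) =
        rateConst / 8 / rateDenom σ ε N * (ε ^ 2 / cmax) := by
      field_simp
    rw [mul_assoc A, prefactor_eq hc0 hε, hB, h1]
    gcongr
  suffices h : 1 - B ≤ P.real E by linarith
  have hT0 := totalCap_nonneg hc N
  have hTN := totalCap_le hcm N
  -- In the first case the Carathéodory bound keeps the deviation below `ε/2` for every choice of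
  -- angles.
  rcases le_or_gt (N * cmax / ε) ((Real.exp σ - 1) / 4) with hX | hX
  · have hall : E = Set.univ := by
      rw [Set.eq_univ_iff_forall]
      intro ω
      refine iSup_clusterFluct_lt hε (half_lt_self hε) fun n hn z hz => ?_
      refine (norm_clusterFluct_le hc _ n hσ hz).trans ?_
      have h1 := totalCap_mono hc hn
      rw [div_le_iff₀ hε] at hX
      rw [div_le_iff₀ he]
      linarith
    have hB0 : 0 ≤ B := by positivity
    rw [hall, probReal_univ]
    linarith
  · by_cases hreg : ε < cmax ∨ 1 < cmax
    · have hA16 : 16 ≤ A := by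
        have : 0 < 16 / rateConst := by positivity
        linarith
      have h1 := one_le_of_large_cap hc0 hε hσ hσ' (by linarith) hεσ hcσ hX.le hA16
        (a := rateConst / 8) (by linarith) hreg
      have h2 : 0 ≤ P.real E := measureReal_nonneg
      linarith
    · push Not at hreg
      obtain ⟨hcε, hc1⟩ := hreg
      set T := totalCap c N with hT
      -- The Bernstein-type term `ε / (σ / 2)` keeps the optimal tilt within the range allowed by
      -- the moment bound.
      set D := variancePotential T (σ / 2) + ε / (σ / 2) with hD
      have hG0 := variancePotential_nonneg (show 0 < σ / 2 by positivity) hT0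
      have hDε : ε / (σ / 2) ≤ D := by linarith
      have hD0 : 0 < D := lt_of_lt_of_le (by positivity) hDε
      have hJ := one_le_jumpConst
      -- This is the minimiser of `16 * jumpConst * cmax * D * ℓ² - ε ℓ / 3`; the minimum is
      -- `-rateConst * ε² / (cmax * D)`.
      set ℓ := 1 / (6 * (16 * jumpConst)) * (ε / (cmax * D)) with hℓ
      have hℓ0 : 0 ≤ ℓ := by positivity
      have hℓs : ℓ * cmax * (16 * jumpConst) ≤ σ / 2 := by
        have h1 : ℓ * cmax * (16 * jumpConst) = ε / D / 6 := by
          rw [hℓ]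
          field_simp
        have h2 : ε / D ≤ σ / 2 := by
          rw [div_le_iff₀ hD0]
          rw [div_le_iff₀ (by positivity)] at hDε
          linarith
        rw [h1]
        linarith
      have hmain := le_measureReal_iSup_lt hm hi hu hc hcm hc1 hσ hcσ hℓ0 hℓs rfl hε N
      have hexp : ℓ ^ 2 * cmax * (16 * jumpConst) * variancePotential T (σ / 2) - ℓ * ε / 3 ≤
          -(rateConst * (ε ^ 2 / (cmax * D))) := by
        have h1 : ℓ ^ 2 * cmax * (16 * jumpConst) * variancePotential T (σ / 2) ≤
            ℓ ^ 2 * cmax * (16 * jumpConst) * D := by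
          gcongr
          have : 0 < ε / (σ / 2) := by positivity
          linarith
        have h2 : ℓ ^ 2 * cmax * (16 * jumpConst) * D - ℓ * ε / 3 =
            -(rateConst * (ε ^ 2 / (cmax * D))) := by
          rw [hℓ, rateConst]
          field_simp
          ring
        linarith
      have hp := prob_le_of_small_cap (p := 1 - P.real E) hc0 hε hσ hσ' (by linarith) hTN hD0
        (effective_denom_le hσ hT0 hεσ) (effective_denom_le_rateDenom hσ hT0 hTN hcε) hX.le
        (by linarith [measureReal_le_one (μ := P) (s := E)])
        (by linarith [measureReal_nonneg (μ := P) (s := E)]) (by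
          have h4 := one_sub_exp_neg_pos (show 0 < σ / 2 by positivity)
          have h5 : (8 * T / (ε * (Real.exp σ - 1)) + 1) * (4 / (1 - Real.exp (-(σ / 2))) *
              Real.exp (ℓ ^ 2 * cmax * (16 * jumpConst) * variancePotential T (σ / 2)
                - ℓ * ε / 3)) ≤
              (8 * T / (ε * (Real.exp σ - 1)) + 1) * (4 / (1 - Real.exp (-(σ / 2))) *
                Real.exp (-(rateConst * (ε ^ 2 / (cmax * D))))) := by gcongr
          linarith)
      linarith
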